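/- Let $(R,\mathfrak m)$ be a one-dimensional, Noetherian, Cohen-Macaulay, analytically unramified local ring (i.e. its $\mathfrak m$-adic completion is reduced) with infinite residue field. Let $Q$ be its total ring of fractions, $\overline R$ the integral closure of $R$ in $Q$, $\mathfrak c=R:\overline R$ the conductor, and $\nu=\dim_{R/\mathfrak m}\mathfrak m/\mathfrak m^2$ the embedding dimension. For $R$-submodules $A,B$ of $Q$ write $A:B=\{z\in Q\mid zB\subseteq A\}$. A fractional ideal is an $R$-submodule $J$ of $Q$ that contains a non-zero-divisor of $Q$ and satisfies $rJ\subseteq R$ for some non-zero-divisor $r\in R$. A canonical ideal is a fractional ideal $\omega$ with $\omega:(\omega:J)=J$ for every fractional ideal $J$. A reduction of an ideal $I$ of $R$ is an ideal $J\subseteq I$ with $JI^n=I^{n+1}$ for some $n\ge 0$, and a minimal reduction of $I$ is a reduction of $I$ that is minimal under inclusion. Suppose that $R$ has a canonical reduction $x\omega$; that is, $(x)$ is a minimal reduction of $\mathfrak m$, $\omega$ is a canonical ideal, and $x\omega$ is an ideal of $R$ that is a reduction of $\mathfrak m$. Suppose also that there are a minimal generating set $\{x,x_2,\dots,x_\nu\}$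 of $\mathfrak m$ and an element $x_i\neq x$ of it with $x_i\in\mathfrak m:\omega$. Then $\mathfrak c$ is $\mathfrak m$-primary, and $$e(\mathfrak c)\le \nu\cdot\ell(R/\mathfrak c),$$ where $\ell$ denotes the length of an $R$-module and $e(\mathfrak c)=\lim_{n\to\infty}\ell(R/\mathfrak c^n)/n$ is the Hilbert-Samuel multiplicity of $\mathfrak c$ (a limit that exists and is a natural number). -/

import Mathlib

open scoped Pointwise

/-- A Noetherian local ring is Cohen-Macaulay if its depth equals its Krull dimension, that is, if
the maximal ideal contains a regular sequence whose length is the Krull dimension. -/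
def IsCohenMacaulayLocalRing (R : Type*) [CommRing R] [IsLocalRing R] : Prop :=
  ∃ rs : List R, (∀ r ∈ rs, r ∈ IsLocalRing.maximalIdeal R) ∧
    RingTheory.Sequence.IsRegular R rs ∧ ringKrullDim R = (rs.length : WithBot ℕ∞)

/-- A local ring is analytically unramified if its completion at the maximal ideal is reduced. -/
def IsAnalyticallyUnramified (R : Type*) [CommRing R] [IsLocalRing R] : Prop :=
  IsReduced (AdicCompletion (IsLocalRing.maximalIdeal R) R)

/-- The embedding dimension of a local ring: the dimension of `𝔪 / 𝔪 ^ 2` over the residue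
field. -/
noncomputable def embeddingDimension (R : Type*) [CommRing R] [IsLocalRing R] : ℕ :=
  Module.finrank (IsLocalRing.ResidueField R) (IsLocalRing.CotangentSpace R)

/-- `J` is a reduction of `I`: `J ⊆ I` and `J * I ^ n = I ^ (n + 1)` for some `n`. -/
def Ideal.IsReductionOf {R : Type*} [CommRing R] (J I : Ideal R) : Prop :=
  J ≤ I ∧ ∃ n : ℕ, J * I ^ n = I ^ (n + 1)

/-- A minimal reduction of `I`: a reduction of `I` that is minimal with respect to inclusion. -/
def Ideal.IsMinimalReductionOf {R : Type*} [CommRing R] (J I : Ideal R) : Prop :=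
  Minimal (fun J' : Ideal R => J'.IsReductionOf I) J

/-- A minimal generating set of an ideal: no proper subset generates the ideal. -/
def Ideal.IsMinimalGeneratingSet {R : Type*} [CommRing R] (I : Ideal R) (S : Set R) : Prop :=
  Minimal (fun T : Set R => Ideal.span T = I) S

/-- The natural number `e` is the Hilbert-Samuel multiplicity of the `𝔪`-primary ideal `I` of the
Noetherian local ring `R` of dimension `d`: it is the limit of `d! * ℓ(R / I ^ n) / n ^ d`. All
these lengths are finite, as `I` is `𝔪`-primary. -/
def Ideal.HasHilbertSamuelMultiplicity {R : Type*} [CommRing R] [IsLocalRing R]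
    (I : Ideal R) (e : ℕ) : Prop :=
  I.radical = IsLocalRing.maximalIdeal R ∧
  ∃ d : ℕ, ringKrullDim R = (d : WithBot ℕ∞) ∧
    Filter.Tendsto
      (fun n : ℕ => (d.factorial : ℝ) * ((Module.length R (R ⧸ I ^ n)).toNat : ℝ) / (n : ℝ) ^ d)
      Filter.atTop (nhds (e : ℝ))

section FractionalIdeals

variable (R Q : Type*) [CommRing R] [CommRing Q] [Algebra R Q]

/-- The conductor `𝔠 = R : R̄`, where `R̄` is the integral closure of `R` in `Q` (which is meant to
be the total ring of fractions of `R`), as an ideal of `R`. Here `I / J` is the colon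
`{z ∈ Q | z J ⊆ I}`, and `1` is `R` as a submodule of `Q`. -/
noncomputable def conductorIdeal : Ideal R :=
  ((1 : Submodule R Q) / Subalgebra.toSubmodule (integralClosure R Q)).comap
    (Algebra.linearMap R Q)

variable {R Q}

/-- A regular fractional ideal: an `R`-submodule of the total ring of fractions `Q` of `R` which
has a common denominator and contains a non-zero-divisor of `Q`. -/
def IsRegularFractionalIdeal (J : Submodule R Q) : Prop :=
  IsFractional (nonZeroDivisors R) J ∧ ∃ z ∈ J, z ∈ nonZeroDivisors Q

/-- A canonical ideal: a regular fractional ideal `ω` with `ω : (ω : J) = J` for every regular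
fractional ideal `J`. -/
def IsCanonicalIdeal (ω : Submodule R Q) : Prop :=
  IsRegularFractionalIdeal ω ∧
    ∀ J : Submodule R Q, IsRegularFractionalIdeal J → ω / (ω / J) = J

variable (Q)

/-- A canonical reduction of a local ring: an ideal which is a canonical ideal and a reduction of
the maximal ideal. -/
def IsCanonicalReduction [IsLocalRing R] (I : Ideal R) : Prop :=
  IsCanonicalIdeal (IsLocalization.coeSubmodule Q I) ∧
    I.IsReductionOf (IsLocalRing.maximalIdeal R)

end FractionalIdeals

/-!
Let `R̄` be the integral closure of `R` in `Q`, `𝔠` the conductor, `𝔪` the maximal ideal, and write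
`ℓ(A / B)` for lengths of `R`-modules (`Submodule.relLength B A`).

The multiplicity is `e(𝔠) = ℓ(R̄ / 𝔠)`: the ring `R̄` is semilocal, and its regular ideals are
invertible, hence principal, so that `𝔠 = z R̄` and `𝔠 ^ n / 𝔠 ^ (n + 1)` is isomorphic to `R̄ / 𝔠`
for `n ≥ 1`. See `Ideal.isPrincipal_of_pow_mem` and
`length_quotient_pow_succ_of_coeSubmodule_eq_smul`.

To bound `ℓ(R̄ / 𝔠) = ℓ(R̄ / R) + ℓ(R / 𝔠)`, note that `(x)` and `x ω` are both reductions of `𝔪`,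
whence `𝔪 R̄ = x R̄` and `ω R̄ = R̄`, and so `𝔠 = (ω : ω) : R̄ = ω : R̄`. Duality into `ω` then gives
`ℓ(R̄ / R) ≤ ℓ(ω / 𝔠)`, and it remains to show that `ℓ(ω / 𝔠) ≤ (ν - 1) ℓ(R / 𝔠)`
(`IsCanonicalIdeal.relLength_div_le`). Put `p = y / x` and `B = x⁻¹ 𝔪`, so that `B ⊆ R̄` and `B`
contains both `ω` and `p ω`. On the one hand, multiplication by `p` embeds `ω / (ω : (R + R p))`
into `B / ω`, and by duality this yields `ℓ(B / ω) ≥ ℓ((R + R p) / R)`. On the other hand,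
`B / (R + R p)` has `ν - 2` generators and is annihilated by `𝔠`, so that
`ℓ(B / 𝔠) ≤ ℓ(R / 𝔠) + ℓ((R + R p) / R) + (ν - 2) ℓ(R / 𝔠)`. As
`ℓ(B / 𝔠) = ℓ(B / ω) + ℓ(ω / 𝔠)`, the estimate follows by cancelling `ℓ((R + R p) / R)`.

All of this needs `R̄` to be finite over `R`, that is, `x ^ N R̄ ⊆ R` for some `N`. Integral elements
are transported to the completion `A` of `R`, which is reduced, so that it is enough to bound the
denominators of the integral closure `S` of `A` in `A[1/x]`. As `A / x` is Artinian, the ideals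
`x ^ n S ∩ A + x A` stabilize, which gives `S = U + x S` for a submodule `U ⊆ x⁻ⁿ A`. Successive
approximation then gives `S ⊆ x⁻ⁿ A`, provided that the ideal `⋂ x ^ k S` vanishes. This is where
reducedness enters: a nonzero element of this ideal would produce an idempotent `e ≠ 0` with `e / x`
integral, and `x` would be a unit of `e A` (`eq_zero_of_forall_pow_mul_isIntegral`).
-/

/-! ### Integral closure over a complete ring -/

theorem exists_forall_pow_dvd_sum_sub {A : Type*} [CommRing A] (x : A)
    [IsPrecomplete (Ideal.span {x}) A] (a : ℕ → A) :
    ∃ l, ∀ k : ℕ, x ^ k ∣ (∑ i ∈ Finset.range k, x ^ i * a i) - l := by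
  have key : ∀ (k : ℕ) (u v : A),
      u ≡ v [SMOD (Ideal.span {x} ^ k • ⊤ : Submodule A A)] ↔ x ^ k ∣ u - v := by
    intro k u v
    rw [SModEq.sub_mem, smul_eq_mul, Ideal.mul_top, Ideal.span_singleton_pow,
      Ideal.mem_span_singleton]
  obtain ⟨l, hl⟩ := IsPrecomplete.prec ‹_› (I := Ideal.span {x})
    (f := fun k ↦ ∑ i ∈ Finset.range k, x ^ i * a i) (by
      intro m n hmn
      rw [key, ← neg_sub, dvd_neg, ← Finset.sum_Ico_eq_sub _ hmn]
      refine Finset.dvd_sum fun i hi ↦ ?_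
      exact (pow_dvd_pow x (Finset.mem_Ico.mp hi).1).mul_right _)
  exact ⟨l, fun k ↦ (key k _ _).mp (hl k)⟩

theorem eq_zero_of_forall_pow_dvd {A : Type*} [CommRing A] (x : A)
    [IsHausdorff (Ideal.span {x}) A] (a : A) (h : ∀ k : ℕ, x ^ k ∣ a) : a = 0 := by
  refine IsHausdorff.haus ‹_› (I := Ideal.span {x}) a fun k ↦ ?_
  rw [SModEq.zero, smul_eq_mul, Ideal.mul_top, Ideal.span_singleton_pow,
    Ideal.mem_span_singleton]
  exact h k

/-- A form of Nakayama's lemma over an `x`-adically complete ring: it is the smaller ideal, and not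
the larger one, that is assumed to be finitely generated. -/
theorem Ideal.le_of_le_sup_span_singleton_mul {A : Type*} [CommRing A] (x : A)
    [IsAdicComplete (Ideal.span {x}) A] {N J : Ideal A} (hN : N.FG)
    (h : J ≤ N ⊔ Ideal.span {x} * J) : J ≤ N := by
  obtain ⟨g, rfl⟩ := hN
  have step : ∀ j : J, ∃ (c : A → A) (r : J), (j : A) = ∑ i ∈ g, c i * i + x * r := by
    rintro ⟨j, hj⟩
    obtain ⟨u, hu, v, hv, huv⟩ := Submodule.mem_sup.mp (h hj)
    obtain ⟨c, hc⟩ := Submodule.mem_span_finset'.mp hu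
    obtain ⟨r, hr, rfl⟩ := Ideal.mem_span_singleton_mul.mp hv
    classical
    refine ⟨fun i ↦ if hi : i ∈ g then c ⟨i, hi⟩ else 0, ⟨r, hr⟩, ?_⟩
    change j = _
    rw [← huv, ← hc, ← Finset.sum_attach g, Finset.univ_eq_attach]
    congr 1
    refine Finset.sum_congr rfl fun i _ ↦ ?_
    simp
  choose c r hcr using step
  intro j hj
  let s : ℕ → J := fun n ↦ r^[n] ⟨j, hj⟩
  have hs : ∀ n, s (n + 1) = r (s n) := fun n ↦ Function.iterate_succ_apply' _ _ _
  have hsum : ∀ n, j = ∑ i ∈ g, (∑ m ∈ Finset.range n, x ^ m * c (s m) i) * i + x ^ n * s n := by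
    intro n
    induction n with
    | zero => simp [s]
    | succ n ih =>
      have e := hcr (s n)
      rw [← hs] at e
      simp only [Finset.sum_range_succ, add_mul, Finset.sum_add_distrib]
      conv_lhs => rw [ih, e]
      rw [mul_add, Finset.mul_sum, pow_succ]
      simp only [mul_assoc, add_assoc]
  choose l hl using fun i : A ↦ exists_forall_pow_dvd_sum_sub x (fun m ↦ c (s m) i)
  have hj' : j = ∑ i ∈ g, l i * i := by
    rw [← sub_eq_zero]
    refine eq_zero_of_forall_pow_dvd x _ fun k ↦ ?_
    conv_rhs => rw [hsum k]
    rw [add_sub_right_comm, ← Finset.sum_sub_distrib]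
    refine dvd_add (Finset.dvd_sum fun i _ ↦ ?_) (Dvd.intro _ rfl)
    rw [← sub_mul]
    exact (hl i k).mul_right _
  rw [hj']
  exact Ideal.sum_mem _ fun i hi ↦ Ideal.mul_mem_left _ _ (Ideal.subset_span hi)

/-- In a reduced `x`-adically complete ring `A` with `A / x` Artinian, the fraction ring `A[1/x]` is
von Neumann regular: this is the relation `d = d ^ 2 * (q / x ^ s)`, cleared of denominators. -/
theorem exists_pow_mul_eq_sq_mul {A : Type*} [CommRing A]
    (x : A) [IsAdicComplete (Ideal.span {x}) A] [IsReduced A]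
    [IsArtinianRing (A ⧸ Ideal.span {x})] (d : A) :
    ∃ (s : ℕ) (q : A), x ^ s * d = d ^ 2 * q := by
  -- the saturations `J n = d ^ n A[1/x] ∩ A`
  let J : ℕ → Ideal A := fun n ↦
    { carrier := {j | ∃ s : ℕ, d ^ n ∣ x ^ s * j}
      zero_mem' := ⟨0, by simp⟩
      add_mem' := by
        rintro a b ⟨s, hs⟩ ⟨t, ht⟩
        refine ⟨s + t, ?_⟩
        have : x ^ (s + t) * (a + b) = x ^ t * (x ^ s * a) + x ^ s * (x ^ t * b) := by ring
        rw [this]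
        exact dvd_add (hs.mul_left _) (ht.mul_left _)
      smul_mem' := by
        rintro c a ⟨s, hs⟩
        refine ⟨s, ?_⟩
        have : x ^ s * (c • a) = c * (x ^ s * a) := by simp only [smul_eq_mul]; ring
        rw [this]
        exact hs.mul_left _ }
  have hsat : ∀ n a, x * a ∈ J n → a ∈ J n := by
    rintro n a ⟨s, hs⟩
    exact ⟨s + 1, by rwa [pow_succ, mul_assoc]⟩
  have hanti : ∀ n, J (n + 1) ≤ J n := by
    rintro n j ⟨s, hs⟩
    exact ⟨s, (pow_dvd_pow d n.le_succ).trans hs⟩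
  let π := Ideal.Quotient.mk (Ideal.span {x})
  let f : ℕ →o (Ideal (A ⧸ Ideal.span {x}))ᵒᵈ :=
    ⟨fun n ↦ OrderDual.toDual ((J n).map π),
      monotone_nat_of_le_succ fun n ↦ Ideal.map_mono (hanti n)⟩
  obtain ⟨n, hn⟩ := IsArtinian.monotone_stabilizes (R := A ⧸ Ideal.span {x})
    (M := A ⧸ Ideal.span {x}) f
  have hmap : (J n).map π = (J (n + 1)).map π := hn (n + 1) (Nat.le_succ n)
  -- finitely many elements of `J (n + 1)` generate its image modulo `x`
  obtain ⟨N, hN, hNJ, hNmap⟩ : ∃ N : Ideal A, N.FG ∧ N ≤ J (n + 1) ∧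
      (J (n + 1)).map π ≤ N.map π := by
    obtain ⟨t, ht, hts⟩ := Submodule.fg_span_iff_fg_span_finset_subset (R := A ⧸ Ideal.span {x})
      (π '' (J (n + 1))) |>.mp (IsNoetherian.noetherian ((J (n + 1)).map π))
    classical
    obtain ⟨t', ht', rfl⟩ := Finset.subset_set_image_iff.mp ht
    refine ⟨Ideal.span t', ⟨t', rfl⟩, Ideal.span_le.mpr ht', ?_⟩
    rw [Ideal.map_span, ← Finset.coe_image]
    exact hts.le
  have hle : J n ≤ N := by
    refine Ideal.le_of_le_sup_span_singleton_mul x hN fun j hj ↦ ?_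
    have hj' : π j ∈ N.map π := hNmap (hmap ▸ Ideal.mem_map_of_mem π hj)
    obtain ⟨u, hu, huj⟩ := (Ideal.mem_map_iff_of_surjective π Ideal.Quotient.mk_surjective).mp hj'
    obtain ⟨a, ha⟩ := Ideal.mem_span_singleton.mp (Ideal.Quotient.eq.mp huj.symm)
    have ha' : a ∈ J n := hsat n a (ha ▸ sub_mem hj (hanti n (hNJ hu)))
    refine Submodule.mem_sup.mpr ⟨u, hu, x * a, ?_, ?_⟩
    · exact Ideal.mul_mem_mul (Ideal.mem_span_singleton_self x) ha'
    · rw [← ha]; ring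
  obtain ⟨s, q, hq⟩ := hNJ (hle (⟨0, by simp⟩ : d ^ n ∈ J n))
  refine ⟨s, q, ?_⟩
  have hnil : (d * (x ^ s - d * q)) ^ (n + 1) = 0 := by
    have h0 : d ^ n * (x ^ s - d * q) = 0 := by
      rw [mul_sub, mul_comm _ (x ^ s), hq]; ring
    calc (d * (x ^ s - d * q)) ^ (n + 1)
        = d ^ n * (x ^ s - d * q) * (d * (x ^ s - d * q) ^ n) := by rw [mul_pow]; ring
      _ = 0 := by rw [h0, zero_mul]
  have := (pow_eq_zero_iff n.succ_ne_zero).mp hnil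
  linear_combination this

/-- Over a ring `A` as in `exists_pow_mul_eq_sq_mul`, no nonzero element of `A` is divisible by all
powers of `x` in the integral closure of `A` in `A[1/x]`. Otherwise this integral closure would
contain `e / x` for an idempotent `e ≠ 0`, and `x` would become a unit in the factor `e A`. -/
theorem eq_zero_of_forall_pow_mul_isIntegral {A L : Type*} [CommRing A] [CommRing L] [Algebra A L]
    (x : A) [IsLocalization.Away x L] (hx : x ∈ nonZeroDivisors A)
    [IsAdicComplete (Ideal.span {x}) A] [IsReduced A] [IsArtinianRing (A ⧸ Ideal.span {x})]
    (d : A) (hd : ∀ k : ℕ, ∃ t : L, IsIntegral A t ∧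
      algebraMap A L x ^ k * t = algebraMap A L d) : d = 0 := by
  have hinj : Function.Injective (algebraMap A L) :=
    IsLocalization.injective L (Submonoid.powers_le.mpr hx)
  have hxk : ∀ (k : ℕ) (a : A), x ^ k * a = 0 → a = 0 := fun k a h ↦ by
    rw [mul_comm] at h
    exact (pow_mem hx k).2 a h
  obtain ⟨s, q, hq⟩ := exists_pow_mul_eq_sq_mul x d
  set φ := algebraMap A L
  have hxu : IsUnit (φ x) := IsLocalization.Away.algebraMap_isUnit x
  obtain ⟨t, ht, htd⟩ := hd (s + 1)
  -- `w / x ^ s` is idempotent and `v = w / x ^ (s + 1)` is integral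
  set w := d * q with hw
  have hww : w * w = x ^ s * w := by
    rw [hw]; linear_combination (-q) * hq
  set v := t * φ q with hv
  have hvint : IsIntegral A v := ht.mul isIntegral_algebraMap
  have hvw : φ x ^ (s + 1) * v = φ w := by
    rw [hv, ← mul_assoc, htd, ← map_mul]
  have hvv : φ x * (v * v) = v := by
    have : φ x ^ (s + 1 + s) * (φ x * (v * v)) = φ x ^ (s + 1 + s) * v := by
      calc φ x ^ (s + 1 + s) * (φ x * (v * v))
          = (φ x ^ (s + 1) * v) * (φ x ^ (s + 1) * v) := by ring
        _ = φ x ^ s * (φ x ^ (s + 1) * v) := by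
            rw [hvw, ← map_mul, hww, map_mul, map_pow]
        _ = _ := by ring
    exact (hxu.pow _).mul_left_cancel this
  have hpow : ∀ i, φ x ^ i * v ^ (i + 1) = v := by
    intro i
    induction i with
    | zero => simp
    | succ i ih =>
      calc φ x ^ (i + 1) * v ^ (i + 1 + 1) = φ x ^ i * v ^ i * (φ x * (v * v)) := by ring
        _ = v := by rw [hvv, mul_assoc, ← pow_succ, ih]
  obtain ⟨p, hp, hpv⟩ := hvint
  have hv0 : ∃ c : A, v = φ c * (φ x * v) := by
    refine ⟨-∑ i ∈ Finset.range p.natDegree, p.coeff i * x ^ (p.natDegree - i - 1), ?_⟩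
    rw [Polynomial.eval₂_eq_sum_range, Finset.sum_range_succ, hp.coeff_natDegree] at hpv
    have h1 := congrArg (fun z ↦ φ x ^ p.natDegree * v * z) hpv
    simp only [mul_zero, map_one, one_mul, mul_add, Finset.mul_sum] at h1
    have h2 : φ x ^ p.natDegree * v * v ^ p.natDegree = v := by
      rw [mul_assoc, ← pow_succ', hpow]
    have h3 : ∀ i ∈ Finset.range p.natDegree, φ x ^ p.natDegree * v * (φ (p.coeff i) * v ^ i)
        = φ (p.coeff i * x ^ (p.natDegree - i - 1)) * (φ x * v) := by
      intro i hi
      have hi' := Finset.mem_range.mp hi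
      obtain ⟨m, hm⟩ : ∃ m, p.natDegree = i + m + 1 := ⟨p.natDegree - i - 1, by omega⟩
      have hm' : p.natDegree - i - 1 = m := by omega
      rw [hm', hm, map_mul, map_pow]
      calc φ x ^ (i + m + 1) * v * (φ (p.coeff i) * v ^ i)
          = φ (p.coeff i) * φ x ^ m * (φ x * (φ x ^ i * v ^ (i + 1))) := by ring
        _ = _ := by rw [hpow]
    rw [h2, Finset.sum_congr rfl h3, ← Finset.sum_mul, ← map_sum] at h1
    rw [map_neg]
    linear_combination h1
  obtain ⟨c, hc⟩ := hv0
  have hunit : IsUnit (1 - c * x) := by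
    have hjac := IsAdicComplete.le_jacobson_bot (Ideal.span {x}) (Ideal.mem_span_singleton_self x)
    have := Ideal.mem_jacobson_bot.mp hjac (-c)
    convert this using 1; ring
  have hv00 : v = 0 := by
    have h : φ (1 - c * x) * v = 0 := by
      rw [map_sub, map_one, map_mul]; linear_combination hc
    exact (hunit.map φ).mul_right_eq_zero.mp h
  have hw0 : w = 0 := hinj (by rw [← hvw, hv00, mul_zero, map_zero])
  refine hxk s d ?_
  rw [hq, sq, mul_assoc, ← hw, hw0, mul_zero]

/-- The integral closure of a reduced `x`-adically complete ring `A` with `A / x` Artinian in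
`A[1/x]` has a power of `x` as a common denominator. -/
theorem exists_forall_isIntegral_pow_mul_eq {A L : Type*} [CommRing A] [CommRing L] [Algebra A L]
    (x : A) [IsLocalization.Away x L] (hx : x ∈ nonZeroDivisors A)
    [IsAdicComplete (Ideal.span {x}) A] [IsReduced A] [IsArtinianRing (A ⧸ Ideal.span {x})] :
    ∃ N : ℕ, ∀ s : L, IsIntegral A s → ∃ a, algebraMap A L x ^ N * s = algebraMap A L a := by
  set φ := algebraMap A L
  have hinj : Function.Injective φ :=
    IsLocalization.injective L (Submonoid.powers_le.mpr hx)
  have hxu : IsUnit (φ x) := IsLocalization.Away.algebraMap_isUnit x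
  have hxint : IsIntegral A (φ x) := isIntegral_algebraMap
  -- the contractions `T n = x ^ n S ∩ A`, where `S` is the integral closure
  let T : ℕ → Ideal A := fun n ↦
    { carrier := {a | ∃ u : L, IsIntegral A u ∧ φ x ^ n * u = φ a}
      zero_mem' := ⟨0, isIntegral_zero, by simp⟩
      add_mem' := by
        rintro a b ⟨u, hu, hua⟩ ⟨v, hv, hvb⟩
        exact ⟨u + v, hu.add hv, by rw [mul_add, hua, hvb, map_add]⟩
      smul_mem' := by
        rintro c a ⟨u, hu, hua⟩
        refine ⟨φ c * u, isIntegral_algebraMap.mul hu, ?_⟩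
        rw [smul_eq_mul, map_mul, ← hua]; ring }
  let π := Ideal.Quotient.mk (Ideal.span {x})
  have hanti : ∀ n, T (n + 1) ≤ T n := by
    rintro n a ⟨u, hu, hua⟩
    exact ⟨φ x * u, hxint.mul hu, by rw [← hua]; ring⟩
  let f : ℕ →o (Ideal (A ⧸ Ideal.span {x}))ᵒᵈ :=
    ⟨fun n ↦ OrderDual.toDual ((T n).map π),
      monotone_nat_of_le_succ fun n ↦ Ideal.map_mono (hanti n)⟩
  obtain ⟨n, hn⟩ := IsArtinian.monotone_stabilizes (R := A ⧸ Ideal.span {x})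
    (M := A ⧸ Ideal.span {x}) f
  have hmap : ∀ m, n ≤ m → ∀ a ∈ T m, ∃ b ∈ T (m + 1), ∃ c, a = b + x * c := by
    intro m hm a ha
    have h1 : (T m).map π = (T (m + 1)).map π :=
      (hn m hm).symm.trans (hn (m + 1) (hm.trans m.le_succ))
    have h2 : π a ∈ (T (m + 1)).map π := h1 ▸ Ideal.mem_map_of_mem π ha
    obtain ⟨b, hb, hba⟩ := (Ideal.mem_map_iff_of_surjective π Ideal.Quotient.mk_surjective).mp h2
    obtain ⟨c, hc⟩ := Ideal.mem_span_singleton.mp (Ideal.Quotient.eq.mp hba.symm)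
    exact ⟨b, hb, c, by rw [← hc]; ring⟩
  -- an integral element with denominator `x ^ (n + k)` has denominator `x ^ n` modulo `x S`
  have hred : ∀ k : ℕ, ∀ u : L, IsIntegral A u → (∃ a, φ x ^ (n + k) * u = φ a) →
      ∃ (a : A) (v : L), IsIntegral A v ∧ φ x ^ n * u = φ a + φ x ^ (n + 1) * v := by
    intro k
    induction k with
    | zero =>
      rintro u hu ⟨a, ha⟩
      exact ⟨a, 0, isIntegral_zero, by simpa using ha⟩
    | succ k ih =>
      rintro u hu ⟨a, ha⟩
      obtain ⟨b, ⟨v, hv, hvb⟩, c, hc⟩ := hmap (n + (k + 1)) (by omega) a ⟨u, hu, ha⟩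
      have h1 : φ x ^ (n + k) * (u - φ x * v) = φ c := by
        refine hxu.mul_left_cancel ?_
        calc φ x * (φ x ^ (n + k) * (u - φ x * v))
            = φ x ^ (n + (k + 1)) * u - φ x ^ (n + (k + 1) + 1) * v := by ring
          _ = φ x * φ c := by rw [ha, hvb, hc, map_add, map_mul]; ring
      obtain ⟨a', v', hv', h'⟩ := ih (u - φ x * v) (hu.sub (hxint.mul hv)) ⟨c, h1⟩
      exact ⟨a', v' + v, hv'.add hv, by linear_combination h'⟩
  have hstep : ∀ u : integralClosure A L, ∃ (a : A) (v : integralClosure A L),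
      φ x ^ n * u = φ a + φ x ^ (n + 1) * v := by
    rintro ⟨u, hu⟩
    obtain ⟨k, a, ha⟩ : ∃ (k : ℕ) (a : A), φ x ^ k * u = φ a := by
      obtain ⟨⟨a, y, k, rfl⟩, h⟩ := IsLocalization.surj (Submonoid.powers x) u
      exact ⟨k, a, by rw [← h, mul_comm]; simp [φ]⟩
    obtain ⟨a', v, hv, h⟩ := hred k u hu ⟨x ^ n * a, by rw [map_mul, map_pow, ← ha]; ring⟩
    exact ⟨a', ⟨v, hv⟩, h⟩
  choose α r hr using hstep
  refine ⟨n, fun s hs ↦ ?_⟩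
  let σ : ℕ → integralClosure A L := fun k ↦ r^[k] ⟨s, hs⟩
  have hσ : ∀ k, σ (k + 1) = r (σ k) := fun k ↦ Function.iterate_succ_apply' _ _ _
  have hsum : ∀ k, φ x ^ n * s
      = φ (∑ i ∈ Finset.range k, x ^ i * α (σ i)) + φ x ^ k * (φ x ^ n * σ k) := by
    intro k
    induction k with
    | zero => simp [σ]
    | succ k ih =>
      rw [ih, hr (σ k), ← hσ, Finset.sum_range_succ, map_add, map_mul, map_pow]
      ring
  obtain ⟨l, hl⟩ := exists_forall_pow_dvd_sum_sub x (fun i ↦ α (σ i))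
  obtain ⟨k₀, b, hb⟩ : ∃ (k : ℕ) (b : A), φ x ^ k * (φ x ^ n * s - φ l) = φ b := by
    obtain ⟨⟨a, y, k, rfl⟩, h⟩ := IsLocalization.surj (Submonoid.powers x) (φ x ^ n * s - φ l)
    exact ⟨k, a, by rw [← h, mul_comm]; simp [φ]⟩
  have hb0 : b = 0 := by
    refine eq_zero_of_forall_pow_mul_isIntegral (L := L) x hx b fun k ↦ ?_
    obtain ⟨c, hc⟩ := hl k
    refine ⟨φ x ^ k₀ * (φ c + φ x ^ n * σ k), ?_, ?_⟩
    · exact (hxint.pow _).mul (isIntegral_algebraMap.add ((hxint.pow _).mul (σ k).2))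
    · rw [← hb, hsum k]
      have := congrArg φ hc
      rw [map_sub, map_mul, map_pow] at this
      linear_combination (-φ x ^ k₀) * this
  refine ⟨l, sub_eq_zero.mp ?_⟩
  rw [hb0, map_zero] at hb
  exact (hxu.pow k₀).mul_right_eq_zero.mp hb

/-! ### Finiteness of the integral closure of an analytically unramified ring -/

theorem IsAdicComplete.of_le_of_pow_le {R M : Type*} [CommRing R] [AddCommGroup M] [Module R M]
    {I J : Ideal R} [IsAdicComplete I M] (hJI : J ≤ I) {k : ℕ} (hIJ : I ^ k ≤ J) :
    IsAdicComplete J M where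
  haus' a ha := IsHausdorff.haus (I := I) inferInstance a fun n ↦
    (ha n).mono (Submodule.smul_mono_left (Ideal.pow_right_mono hJI n))
  prec' f hf := by
    obtain ⟨L, hL⟩ := IsPrecomplete.prec (I := I) inferInstance (f := f) fun {m n} hmn ↦
      (hf hmn).mono (Submodule.smul_mono_left (Ideal.pow_right_mono hJI m))
    refine ⟨L, fun n ↦ (hf (le_max_left n (k * n))).trans ((hL (max n (k * n))).mono ?_)⟩
    refine Submodule.smul_mono_left ((Ideal.pow_le_pow_right (le_max_right n (k * n))).trans ?_)
    rw [pow_mul]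
    exact Ideal.pow_right_mono hIJ n

theorem isArtinianRing_quotient_span_singleton {R : Type*} [CommRing R] [IsNoetherianRing R]
    (hdim : ringKrullDim R ≤ 1) {b : R} (hb : b ∈ nonZeroDivisors R) :
    IsArtinianRing (R ⧸ Ideal.span {b}) := by
  rw [isArtinianRing_iff_krullDimLE_zero, Ring.krullDimLE_iff,
    ← ENat.WithBot.add_le_add_one_right_iff, Nat.cast_zero, zero_add]
  exact (ringKrullDim_quotient_succ_le_of_nonZeroDivisor hb).trans hdim

theorem exists_dvd_pow_of_mem_maximalIdeal {R : Type*} [CommRing R] [IsLocalRing R]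
    [IsNoetherianRing R] (hdim : ringKrullDim R ≤ 1) {b x : R} (hb : b ∈ nonZeroDivisors R)
    (hx : x ∈ IsLocalRing.maximalIdeal R) : ∃ k : ℕ, b ∣ x ^ k := by
  by_cases hbu : IsUnit b
  · exact ⟨0, hbu.dvd⟩
  have := isArtinianRing_quotient_span_singleton hdim hb
  have : Nontrivial (R ⧸ Ideal.span {b}) :=
    Ideal.Quotient.nontrivial_iff.mpr (by rwa [Ne, Ideal.span_singleton_eq_top])
  have : IsLocalRing (R ⧸ Ideal.span {b}) :=
    IsLocalRing.of_surjective' (Ideal.Quotient.mk _) Ideal.Quotient.mk_surjective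
  have : Ring.KrullDimLE 0 (R ⧸ Ideal.span {b}) := isArtinianRing_iff_krullDimLE_zero.mp ‹_›
  have hmem : Ideal.Quotient.mk (Ideal.span {b}) x ∈
      IsLocalRing.maximalIdeal (R ⧸ Ideal.span {b}) := by
    rw [IsLocalRing.mem_maximalIdeal, mem_nonunits_iff]
    intro hu
    have hloc : IsLocalHom (Ideal.Quotient.mk (Ideal.span {b})) :=
      IsLocalHom.of_surjective _ Ideal.Quotient.mk_surjective
    exact (IsLocalRing.mem_maximalIdeal x).mp hx (hloc.map_nonunit x hu)
  obtain ⟨k, hk⟩ := Ring.KrullDimLE.isNilpotent_iff_mem_maximalIdeal.mpr hmem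
  rw [← map_pow, Ideal.Quotient.eq_zero_iff_mem, Ideal.mem_span_singleton] at hk
  exact ⟨k, hk⟩

/-- A parameter `x` of a one-dimensional Noetherian local ring inverts all nonzerodivisors. -/
theorem isLocalizationAway_of_isFractionRing {R Q : Type*} [CommRing R] [IsLocalRing R]
    [IsNoetherianRing R] [CommRing Q] [Algebra R Q] [IsFractionRing R Q]
    (hdim : ringKrullDim R ≤ 1) {x : R} (hx : x ∈ nonZeroDivisors R)
    (hxm : x ∈ IsLocalRing.maximalIdeal R) : IsLocalization.Away x Q where
  map_units := by
    rintro ⟨_, k, rfl⟩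
    exact IsLocalization.map_units Q (⟨x ^ k, pow_mem hx k⟩ : nonZeroDivisors R)
  surj z := by
    obtain ⟨⟨a, b, hb⟩, h⟩ := IsLocalization.surj (nonZeroDivisors R) z
    obtain ⟨k, c, hc⟩ := exists_dvd_pow_of_mem_maximalIdeal hdim hb hxm
    refine ⟨⟨a * c, x ^ k, k, rfl⟩, ?_⟩
    simp only at h ⊢
    rw [hc, map_mul, map_mul, ← h, mul_assoc]
  exists_of_eq {a b} h := ⟨1, by rw [IsFractionRing.injective R Q h]⟩

/-- The integral closure of a one-dimensional analytically unramified Noetherian local ring `R` in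
its total ring of fractions has a common denominator; that is, it is a finite `R`-module. The
denominator is found over the completion, to which integral elements are transported. -/
theorem exists_forall_isIntegral_pow_mul_eq_of_isAnalyticallyUnramified {R Q : Type*} [CommRing R]
    [IsLocalRing R] [IsNoetherianRing R] [CommRing Q] [Algebra R Q] [IsFractionRing R Q]
    (hdim : ringKrullDim R ≤ 1) (hunr : IsAnalyticallyUnramified R) {x : R}
    (hx : x ∈ nonZeroDivisors R) (hxm : x ∈ IsLocalRing.maximalIdeal R) {k : ℕ}
    (hk : IsLocalRing.maximalIdeal R ^ k ≤ Ideal.span {x}) :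
    ∃ N : ℕ, ∀ z : Q, IsIntegral R z →
      ∃ a : R, algebraMap R Q x ^ N * z = algebraMap R Q a := by
  set m := IsLocalRing.maximalIdeal R
  let A := AdicCompletion m R
  have hfg : m.FG := Ideal.fg_of_isNoetherianRing m
  have : IsReduced A := hunr
  set ξ : A := algebraMap R A x
  have hξ : ξ ∈ nonZeroDivisors A := by
    have h : IsSMulRegular A ξ := IsSMulRegular.of_flat (S := A) (x := x) (by
      intro a b hab
      have : x * a = x * b := hab
      exact (mem_nonZeroDivisors_iff_right.mp hx |> fun h ↦ sub_eq_zero.mp (h _ (by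
        rw [sub_mul, mul_comm a, mul_comm b, this, sub_self]))))
    rw [mem_nonZeroDivisors_iff_right]
    intro a ha
    refine h ?_
    change ξ * a = ξ * 0
    rw [mul_zero, mul_comm, ha]
  have hxle : Ideal.span {x} ≤ m := (Ideal.span_singleton_le_iff_mem _).mpr hxm
  have hcomplete : IsAdicComplete (Ideal.span {ξ}) A := by
    have : IsAdicComplete m A := AdicCompletion.isAdicComplete hfg
    have : IsAdicComplete (Ideal.span {x}) A := .of_le_of_pow_le hxle hk
    have h := (IsAdicComplete.map_algebraMap_iff (S := A) (Ideal.span {x}) A).mpr this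
    rwa [Ideal.map_span, Set.image_singleton] at h
  -- `A` is `R` modulo a high power of `m`, hence modulo any power of `x`
  have hdense : ∀ (l : ℕ) (a : A), ∃ r : R, ∃ b ∈ (m ^ l).map (algebraMap R A),
      a = algebraMap R A r + b := by
    intro l a
    obtain ⟨r, hr⟩ := Submodule.Quotient.mk_surjective _ (AdicCompletion.eval m R l a)
    refine ⟨r, a - algebraMap R A r, ?_, by ring⟩
    rw [← Submodule.restrictScalars_mem R, ← Ideal.smul_top_eq_map,
      AdicCompletion.pow_smul_top_eq_ker_eval hfg, LinearMap.mem_ker, map_sub, ← hr, sub_eq_zero]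
    rfl
  have hart : IsArtinianRing (A ⧸ Ideal.span {ξ}) := by
    have := isArtinianRing_quotient_span_singleton hdim hx
    let g : R ⧸ Ideal.span {x} →+* A ⧸ Ideal.span {ξ} :=
      Ideal.quotientMap _ (algebraMap R A) (by
        rw [Ideal.span_singleton_le_iff_mem, Ideal.mem_comap]
        exact Ideal.mem_span_singleton_self _)
    refine Function.Surjective.isArtinianRing (f := g) fun b ↦ ?_
    obtain ⟨a, rfl⟩ := Ideal.Quotient.mk_surjective b
    obtain ⟨r, c, hc, rfl⟩ := hdense k a
    refine ⟨Ideal.Quotient.mk _ r, ?_⟩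
    rw [Ideal.quotientMap_mk, Ideal.Quotient.eq]
    have : c ∈ Ideal.span {ξ} := by
      have := Ideal.map_mono (f := algebraMap R A) hk hc
      rwa [Ideal.map_span, Set.image_singleton] at this
    rw [sub_add_cancel_left]
    exact neg_mem this
  have hdescend : ∀ (s : ℕ) (a : R), ξ ^ s ∣ algebraMap R A a → x ^ s ∣ a := by
    rintro s a ⟨c, hc⟩
    have hks : m ^ (k * s) ≤ Ideal.span {x ^ s} := by
      rw [pow_mul, ← Ideal.span_singleton_pow]
      exact Ideal.pow_right_mono hk s
    obtain ⟨r, b, hb, rfl⟩ := hdense (k * s) c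
    have h1 : algebraMap R A (a - x ^ s * r) ∈ (m ^ (k * s)).map (algebraMap R A) := by
      rw [map_sub, hc, map_mul, map_pow]
      convert Ideal.mul_mem_left _ (ξ ^ s) hb using 1
      ring
    rw [← Submodule.restrictScalars_mem R, ← Ideal.smul_top_eq_map,
      AdicCompletion.pow_smul_top_eq_ker_eval hfg, LinearMap.mem_ker] at h1
    have h2 : a - x ^ s * r ∈ (m ^ (k * s) • ⊤ : Submodule R R) :=
      (Submodule.Quotient.mk_eq_zero _).mp h1
    rw [smul_eq_mul, Ideal.mul_top] at h2
    have h3 := Ideal.mem_span_singleton.mp (hks h2)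
    have := dvd_add h3 (Dvd.intro r rfl : x ^ s ∣ x ^ s * r)
    simpa using this
  let L := Localization.Away ξ
  obtain ⟨N, hN⟩ := exists_forall_isIntegral_pow_mul_eq (L := L) ξ hξ
  have hAL : Function.Injective (algebraMap A L) :=
    IsLocalization.injective L (Submonoid.powers_le.mpr hξ)
  have hξu : IsUnit (algebraMap A L ξ) := IsLocalization.Away.algebraMap_isUnit ξ
  have := isLocalizationAway_of_isFractionRing (Q := Q) hdim hx hxm
  have hxL : algebraMap R L x = algebraMap A L ξ := IsScalarTower.algebraMap_apply R A L x
  let φ : Q →ₐ[R] L := IsLocalization.liftAlgHom (M := Submonoid.powers x) (f := Algebra.ofId R L)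
    (by
      rintro ⟨_, j, rfl⟩
      change IsUnit (algebraMap R L (x ^ j))
      rw [map_pow, hxL]
      exact hξu.pow j)
  refine ⟨N, fun z hz ↦ ?_⟩
  obtain ⟨⟨a, y, s, rfl⟩, hzs⟩ := IsLocalization.surj (Submonoid.powers x) z
  simp only [map_pow] at hzs
  obtain ⟨c, hc⟩ := hN (φ z) (hz.map φ).tower_top
  have h1 : φ z * algebraMap A L ξ ^ s = algebraMap A L (algebraMap R A a) := by
    have := congrArg φ hzs
    rwa [map_mul, map_pow, AlgHom.commutes, AlgHom.commutes, hxL,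
      IsScalarTower.algebraMap_apply R A L a] at this
  have h2 : algebraMap R A (x ^ N * a) = ξ ^ s * c := by
    apply hAL
    rw [map_mul, map_mul, map_mul, ← h1, ← hc, map_pow, map_pow, map_pow]
    ring
  obtain ⟨b, hb⟩ := hdescend s (x ^ N * a) ⟨c, h2⟩
  refine ⟨b, ?_⟩
  have hxu : IsUnit (algebraMap R Q x) := IsLocalization.Away.algebraMap_isUnit x
  refine (hxu.pow s).mul_left_cancel ?_
  have := congrArg (algebraMap R Q) hb
  rw [map_mul, map_mul, map_pow, map_pow, ← hzs] at this
  rw [← this]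
  ring

/-! ### Principal ideals in one-dimensional integrally closed rings -/

/-- The determinant trick: multipliers of a finitely generated submodule that contains a unit are
integral. -/
theorem isIntegral_of_forall_mul_mem {R Q : Type*} [CommRing R] [CommRing Q] [Algebra R Q]
    {N : Submodule R Q} (hN : N.FG) {u : Q} (huN : u ∈ N) (hu : IsUnit u) {q : Q}
    (h : ∀ n ∈ N, q * n ∈ N) : IsIntegral R q := by
  have : Module.Finite R N := Module.Finite.iff_fg.mpr hN
  let f : Module.End R N := (LinearMap.mulLeft R q).restrict h
  obtain ⟨p, hp, hpf⟩ := LinearMap.exists_monic_and_aeval_eq_zero R f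
  refine ⟨p, hp, ?_⟩
  have hpow : ∀ (i : ℕ) (n : N), ((f ^ i) n : Q) = q ^ i * n := by
    intro i
    induction i with
    | zero => simp
    | succ i ih =>
      intro n
      rw [pow_succ', Module.End.mul_apply]
      change q * ((f ^ i) n : Q) = _
      rw [ih]; ring
  have h0 := congrArg (fun n : N ↦ (n : Q)) (LinearMap.congr_fun hpf ⟨u, huN⟩)
  rw [Polynomial.aeval_eq_sum_range] at h0
  simp only [LinearMap.sum_apply, LinearMap.smul_apply, AddSubmonoidClass.coe_finsetSum,
    Submodule.coe_smul, hpow, LinearMap.zero_apply, Submodule.coe_zero] at h0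
  rw [Polynomial.eval₂_eq_sum_range]
  refine hu.mul_left_eq_zero.mp ?_
  rw [Finset.sum_mul, ← h0]
  refine Finset.sum_congr rfl fun i _ ↦ ?_
  rw [Algebra.smul_def, mul_assoc]

/-- Let `O` be a Noetherian ring in which all primes containing `x` are maximal, and which is
integrally closed in an overring `Q` containing `1 / x`. Then each ideal containing a power of `x`
is invertible. -/
theorem Ideal.exists_mul_eq_span_pow {O Q : Type*} [CommRing O] [IsNoetherianRing O] [CommRing Q]
    [Algebra O Q] (hinj : Function.Injective (algebraMap O Q)) {x : O}
    (hxu : IsUnit (algebraMap O Q x))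
    (hclosed : ∀ q : Q, IsIntegral O q → ∃ o, algebraMap O Q o = q)
    (hmax : ∀ P : Ideal O, P.IsPrime → x ∈ P → P.IsMaximal)
    (J : Ideal O) {k : ℕ} (hJ : x ^ k ∈ J) : ∃ J' : Ideal O, J * J' = Ideal.span {x ^ k} := by
  have hcancel : ∀ a b : O, x ^ k * a = x ^ k * b → a = b := fun a b h ↦ by
    refine hinj ((hxu.pow k).mul_left_cancel ?_)
    rw [← map_pow, ← map_mul, h, map_mul]
  let J' : Ideal O :=
    { carrier := {t | ∀ j ∈ J, x ^ k ∣ t * j}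
      zero_mem' := fun j _ ↦ by simp
      add_mem' := fun ha hb j hj ↦ by rw [add_mul]; exact dvd_add (ha j hj) (hb j hj)
      smul_mem' := fun c a ha j hj ↦ by
        rw [smul_eq_mul, mul_assoc]; exact (ha j hj).mul_left c }
  have hxJ' : x ^ k ∈ J' := fun j _ ↦ Dvd.intro _ rfl
  refine ⟨J', le_antisymm (Ideal.mul_le.mpr fun j hj t ht ↦ ?_) ?_⟩
  · rw [Ideal.mem_span_singleton, mul_comm]
    exact ht j hj
  -- `J J' = x ^ k I`, and the multiplier ring of `J'` rules out `I ≠ O`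
  let I : Ideal O := Submodule.comap (LinearMap.mulLeft O (x ^ k)) (J * J')
  have hI : ∀ t, t ∈ I ↔ x ^ k * t ∈ J * J' := fun t ↦ Iff.rfl
  rw [Ideal.span_singleton_le_iff_mem]
  suffices I = ⊤ by simpa [hI] using (Ideal.eq_top_iff_one I).mp this
  by_contra hne
  obtain ⟨M, hM, hIM⟩ := Ideal.exists_le_maximal I hne
  have hxM : x ^ k ∈ M := hIM ((hI _).mpr (Ideal.mul_mem_mul hJ hxJ'))
  have hmin : M ∈ ((Ideal.span {x ^ k}).colon {(1 : O)}).minimalPrimes := by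
    have hcolon : (Ideal.span {x ^ k}).colon {(1 : O)} = Ideal.span {x ^ k} := by
      ext t; rw [Submodule.mem_colon_singleton, smul_eq_mul, mul_one]
    rw [hcolon]
    refine ⟨⟨hM.isPrime, (Ideal.span_singleton_le_iff_mem M).mpr hxM⟩, fun P hP hPM ↦ ?_⟩
    have hxP : x ∈ P := hP.1.mem_of_pow_mem k ((Ideal.span_singleton_le_iff_mem P).mp hP.2)
    exact ((hmax P hP.1 hxP).eq_of_le hM.ne_top hPM).ge
  obtain ⟨s, hs⟩ := Submodule.exists_eq_colon_of_mem_minimalPrimes hmin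
  have hsM : ∀ t ∈ M, x ^ k ∣ t * s := fun t ht ↦ by
    rw [hs, Submodule.mem_colon_singleton, Ideal.mem_span_singleton] at ht
    exact ht
  have hsJ' : ∀ t ∈ J', ∃ u ∈ J', s * t = x ^ k * u := by
    have hdvd : ∀ t ∈ J', ∀ j ∈ J, x ^ k * x ^ k ∣ s * t * j := by
      intro t ht j hj
      obtain ⟨i, hi⟩ := ht j hj
      have hiM : i ∈ M := hIM ((hI i).mpr (hi ▸ mul_comm t j ▸ Ideal.mul_mem_mul hj ht))
      obtain ⟨v, hv⟩ := hsM i hiM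
      exact ⟨v, by rw [mul_assoc, hi]; linear_combination x ^ k * hv⟩
    intro t ht
    obtain ⟨u, hu⟩ := hdvd t ht _ hJ
    have hu' : s * t = x ^ k * u := hcancel _ _ (by linear_combination hu)
    refine ⟨u, fun j hj ↦ ?_, hu'⟩
    obtain ⟨v, hv⟩ := hdvd t ht j hj
    exact ⟨v, hcancel _ _ (by rw [← mul_assoc, ← mul_assoc, ← hu', hv])⟩
  obtain ⟨y, hy⟩ := (hxu.pow k).exists_right_inv
  have hint : IsIntegral O (algebraMap O Q s * y) := by
    refine isIntegral_of_forall_mul_mem (N := Submodule.map (Algebra.linearMap O Q) J')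
      (Submodule.FG.map _ ((isNoetherianRing_iff_ideal_fg O).mp ‹_› J'))
      (Submodule.mem_map_of_mem hxJ') (by simpa using hxu.pow k) ?_
    rintro _ ⟨t, ht, rfl⟩
    obtain ⟨u, hu, hst⟩ := hsJ' t ht
    refine ⟨u, hu, ?_⟩
    have := congrArg (algebraMap O Q) hst
    rw [map_mul, map_mul, map_pow] at this
    simp only [Algebra.linearMap_apply]
    linear_combination (-algebraMap O Q u) * hy - y * this
  obtain ⟨o, ho⟩ := hclosed _ hint
  have hso : s = x ^ k * o := hinj (by
    rw [map_mul, map_pow, ho]; linear_combination (-algebraMap O Q s) * hy)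
  refine hM.ne_top ((Ideal.eq_top_iff_one M).mpr ?_)
  rw [hs, Submodule.mem_colon_singleton, Ideal.mem_span_singleton, one_smul, hso]
  exact Dvd.intro _ rfl

/-- An ideal that contains a power of `x` is principal, if moreover all maximal ideals of `O`
contain `x`: there are finitely many of them, and an invertible ideal of a semilocal ring is
principal. -/
theorem Ideal.isPrincipal_of_pow_mem {O Q : Type*} [CommRing O] [IsNoetherianRing O] [CommRing Q]
    [Algebra O Q] (hinj : Function.Injective (algebraMap O Q)) {x : O}
    (hxu : IsUnit (algebraMap O Q x))
    (hclosed : ∀ q : Q, IsIntegral O q → ∃ o, algebraMap O Q o = q)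
    (hmax : ∀ P : Ideal O, P.IsPrime → x ∈ P → P.IsMaximal)
    (hjac : ∀ M : Ideal O, M.IsMaximal → x ∈ M)
    (J : Ideal O) {k : ℕ} (hJ : x ^ k ∈ J) : J.IsPrincipal := by
  obtain ⟨J', hJJ'⟩ := J.exists_mul_eq_span_pow hinj hxu hclosed hmax hJ
  have hfin : {M : Ideal O | M.IsMaximal}.Finite := by
    refine (Ideal.finite_minimalPrimes_of_isNoetherianRing O (Ideal.span {x})).subset ?_
    intro M hM
    refine ⟨⟨hM.isPrime, (Ideal.span_singleton_le_iff_mem M).mpr (hjac M hM)⟩, fun P hP hPM ↦ ?_⟩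
    exact ((hmax P hP.1 ((Ideal.span_singleton_le_iff_mem P).mp hP.2)).eq_of_le hM.ne_top hPM).ge
  refine Ideal.IsPrincipal.of_finite_maximals_of_isUnit hfin ?_
  have hx : x ∈ nonZeroDivisors O := by
    rw [mem_nonZeroDivisors_iff_right]
    intro a ha
    refine hinj (hxu.mul_left_eq_zero.mp ?_ |>.trans (map_zero _).symm)
    rw [← map_mul, ha, map_zero]
  refine isUnit_of_mul_isUnit_left (y := (J' : FractionalIdeal (nonZeroDivisors O)
    (FractionRing O))) ?_
  rw [← FractionalIdeal.coeIdeal_mul, hJJ', FractionalIdeal.coeIdeal_span_singleton]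
  have hu : IsUnit (algebraMap O (FractionRing O) (x ^ k)) :=
    IsLocalization.map_units (FractionRing O) (⟨x ^ k, pow_mem hx k⟩ : nonZeroDivisors O)
  obtain ⟨y, hy⟩ := hu.exists_right_inv
  refine IsUnit.of_mul_eq_one (FractionalIdeal.spanSingleton _ y) ?_
  rw [FractionalIdeal.spanSingleton_mul_spanSingleton, hy, FractionalIdeal.spanSingleton_one]

/-! ### Lengths of subquotients -/

/-- The length of `A / B` for submodules `B ≤ A`. For general `A` and `B`, it is the length of
`A / (A ⊓ B)`. -/
noncomputable def Submodule.relLength {R M : Type*} [Ring R] [AddCommGroup M] [Module R M]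
    (B A : Submodule R M) : ℕ∞ :=
  Module.length R (A ⧸ B.submoduleOf A)

namespace Submodule

section Module

variable {R M : Type*} [Ring R] [AddCommGroup M] [Module R M]

theorem relLength_le_of_linearMap {A B C D : Submodule R M} (g : M →ₗ[R] M)
    (hD : ∀ d ∈ D, g d ∈ A) (hC : ∀ d ∈ D, g d ∈ B ↔ d ∈ C) :
    C.relLength D ≤ B.relLength A := by
  let f : D →ₗ[R] A := g.restrict hD
  have hf : C.submoduleOf D = (B.submoduleOf A).comap f := by
    ext ⟨d, hd⟩
    exact (hC d hd).symm
  refine Module.length_le_of_injective ((C.submoduleOf D).mapQ (B.submoduleOf A) f hf.le) ?_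
  rw [← LinearMap.ker_eq_bot, Submodule.mapQ, Submodule.ker_liftQ, LinearMap.ker_comp,
    Submodule.ker_mkQ, ← hf, ← le_bot_iff, Submodule.map_le_iff_le_comap]
  intro d hd
  simpa using hd

theorem relLength_add {A B C : Submodule R M} (hCB : C ≤ B) (hBA : B ≤ A) :
    C.relLength B + B.relLength A = C.relLength A := by
  let f : (B ⧸ C.submoduleOf B) →ₗ[R] (A ⧸ C.submoduleOf A) :=
    (C.submoduleOf B).mapQ (C.submoduleOf A) (Submodule.inclusion hBA) fun _ h ↦ h
  let g : (A ⧸ C.submoduleOf A) →ₗ[R] (A ⧸ B.submoduleOf A) :=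
    Submodule.factor fun _ h ↦ hCB h
  refine (Module.length_eq_add_of_exact f g ?_ ?_ ?_).symm
  · rw [← LinearMap.ker_eq_bot, LinearMap.ker_eq_bot']
    intro z hz
    obtain ⟨b, rfl⟩ := Submodule.Quotient.mk_surjective _ z
    have hb : (b : M) ∈ C := (Submodule.Quotient.mk_eq_zero (C.submoduleOf A)).mp hz
    exact (Submodule.Quotient.mk_eq_zero _).mpr hb
  · exact Submodule.factor_surjective _
  · intro z
    obtain ⟨a, rfl⟩ := Submodule.Quotient.mk_surjective _ z
    constructor
    · intro h
      have h' : a ∈ B.submoduleOf A := (Submodule.Quotient.mk_eq_zero _).mp h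
      exact ⟨Submodule.Quotient.mk ⟨a, h'⟩, rfl⟩
    · rintro ⟨w, hw⟩
      obtain ⟨b, rfl⟩ := Submodule.Quotient.mk_surjective _ w
      rw [← hw]
      exact (Submodule.Quotient.mk_eq_zero _).mpr b.2

/-- Length is the Krull dimension of the lattice of submodules, so a strictly antitone map between
intervals of submodules bounds lengths. -/
theorem relLength_le_of_strictAntiOn {A B C D : Submodule R M}
    (hBA : B ≤ A) (F : Submodule R M → Submodule R M) (hF : StrictAntiOn F (Set.Icc B A))
    (hmaps : ∀ X ∈ Set.Icc B A, F X ∈ Set.Icc C D) : B.relLength A ≤ C.relLength D := by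
  let up : Submodule R (A ⧸ B.submoduleOf A) → Submodule R M :=
    fun N ↦ (N.comap (B.submoduleOf A).mkQ).map A.subtype
  have hup : StrictMono up :=
    (Submodule.map_strictMono_of_injective A.subtype_injective).comp
      (Submodule.comap_strictMono_of_surjective (Submodule.mkQ_surjective _))
  have hupm : ∀ N, up N ∈ Set.Icc B A := by
    refine fun N ↦ ⟨fun b hb ↦ ⟨⟨b, hBA hb⟩, ?_, rfl⟩, Submodule.map_subtype_le _ _⟩
    have : (B.submoduleOf A).mkQ ⟨b, hBA hb⟩ = 0 := (Submodule.Quotient.mk_eq_zero _).mpr hb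
    change (B.submoduleOf A).mkQ ⟨b, hBA hb⟩ ∈ N
    rw [this]
    exact N.zero_mem
  let down : Submodule R M → Submodule R (D ⧸ C.submoduleOf D) :=
    fun X ↦ (X.submoduleOf D).map (C.submoduleOf D).mkQ
  have hdown : ∀ X ∈ Set.Icc C D,
      ((down X).comap (C.submoduleOf D).mkQ).map D.subtype = X := by
    rintro X ⟨hCX, hXD⟩
    rw [Submodule.comap_map_mkQ, sup_eq_right.mpr (show C.submoduleOf D ≤ X.submoduleOf D from
      fun _ h ↦ hCX h)]
    exact Submodule.map_comap_eq_self (by simpa using hXD)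
  have hdm : Monotone down := fun X Y h ↦ Submodule.map_mono fun _ hz ↦ h hz
  have hlt : StrictMono fun N ↦ OrderDual.toDual (down (F (up N))) := by
    intro N N' h
    have h1 : F (up N') < F (up N) := hF (hupm N) (hupm N') (hup h)
    refine (hdm h1.le).lt_of_ne fun heq ↦ h1.ne ?_
    rw [← hdown _ (hmaps _ (hupm N)), ← hdown _ (hmaps _ (hupm N')), heq]
  have := Order.krullDim_le_of_strictMono _ hlt
  rw [Order.krullDim_orderDual, ← Module.coe_length, ← Module.coe_length] at this
  exact WithBot.coe_le_coe.mp this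

end Module

section CommRing

variable {R M : Type*} [CommRing R] [AddCommGroup M] [Module R M]

theorem relLength_sup_span_singleton_le {B : Submodule R M} {J : Ideal R} {a : M}
    (h : ∀ r ∈ J, r • a ∈ B) : B.relLength (B ⊔ R ∙ a) ≤ Module.length R (R ⧸ J) := by
  have ha : a ∈ B ⊔ R ∙ a := Submodule.mem_sup_right (Submodule.mem_span_singleton_self a)
  let f : R →ₗ[R] _ := (B.submoduleOf (B ⊔ R ∙ a)).mkQ ∘ₗ LinearMap.toSpanSingleton R _ ⟨a, ha⟩
  refine Module.length_le_of_surjective (Submodule.liftQ J f ?_) ?_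
  · intro r hr
    exact (Submodule.Quotient.mk_eq_zero _).mpr (h r hr)
  · intro z
    obtain ⟨⟨w, hw⟩, rfl⟩ := Submodule.Quotient.mk_surjective _ z
    obtain ⟨b, hb, c, hc, rfl⟩ := Submodule.mem_sup.mp hw
    obtain ⟨r, rfl⟩ := Submodule.mem_span_singleton.mp hc
    refine ⟨Submodule.Quotient.mk r, ?_⟩
    refine (Submodule.Quotient.eq _).mpr ?_
    change r • a - (b + r • a) ∈ B
    simpa using hb

theorem relLength_sup_span_le {B : Submodule R M} {J : Ideal R} (s : Finset M)
    (h : ∀ a ∈ s, ∀ r ∈ J, r • a ∈ B) :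
    B.relLength (B ⊔ span R s) ≤ s.card * Module.length R (R ⧸ J) := by
  classical
  induction s using Finset.induction_on with
  | empty =>
    rw [Finset.coe_empty, Submodule.span_empty, sup_bot_eq, relLength, Submodule.submoduleOf_self]
    simp
  | insert a s ha ih =>
    have hs : B ⊔ span R (insert a s : Finset M) = (B ⊔ span R s) ⊔ R ∙ a := by
      rw [Finset.coe_insert, Submodule.span_insert, sup_assoc, sup_comm (R ∙ a)]
    rw [hs, ← relLength_add le_sup_left le_sup_left, Finset.card_insert_of_notMem ha]
    push_cast
    rw [add_mul, one_mul]
    refine add_le_add (ih fun b hb ↦ h b (Finset.mem_insert_of_mem hb)) ?_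
    exact relLength_sup_span_singleton_le fun r hr ↦
      Submodule.mem_sup_left (h a (Finset.mem_insert_self a s) r hr)

end CommRing

section Algebra

variable {R Q : Type*} [CommRing R] [CommRing Q] [Algebra R Q]

theorem relLength_smul {u : Q} (hu : IsUnit u) (A B : Submodule R Q) :
    (u • B).relLength (u • A) = B.relLength A := by
  obtain ⟨v, hv⟩ := hu.exists_right_inv
  have key : ∀ (X : Submodule R Q) (q : Q), q ∈ u • X ↔ v * q ∈ X := by
    intro X q
    rw [Submodule.mem_smul_pointwise_iff_exists]
    constructor
    · rintro ⟨w, hw, rfl⟩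
      rwa [smul_eq_mul, ← mul_assoc, mul_comm v, hv, one_mul]
    · intro h
      exact ⟨v * q, h, by rw [smul_eq_mul, ← mul_assoc, hv, one_mul]⟩
  have key' : ∀ (X : Submodule R Q) (q : Q), u * q ∈ u • X ↔ q ∈ X := by
    intro X q
    rw [key, ← mul_assoc, mul_comm v, hv, one_mul]
  exact le_antisymm
    (relLength_le_of_linearMap (LinearMap.mulLeft R v) (fun d hd ↦ (key A d).mp hd)
      fun d _ ↦ (key B d).symm)
    (relLength_le_of_linearMap (LinearMap.mulLeft R u) (fun d hd ↦ (key' A d).mpr hd)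
      fun d _ ↦ key' B d)

theorem relLength_coeSubmodule_one (hinj : Function.Injective (algebraMap R Q)) (I : Ideal R) :
    (IsLocalization.coeSubmodule Q I).relLength 1 = Module.length R (R ⧸ I) := by
  have hmem : ∀ r : R, algebraMap R Q r ∈ (1 : Submodule R Q) := fun r ↦
    Submodule.algebraMap_mem r
  let f : R →ₗ[R] (1 : Submodule R Q) := (Algebra.linearMap R Q).codRestrict 1 hmem
  let g := ((IsLocalization.coeSubmodule Q I).submoduleOf 1).mkQ ∘ₗ f
  have hker : g.ker = I := by
    ext r
    rw [LinearMap.mem_ker]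
    constructor
    · intro h
      obtain ⟨r', hr', h'⟩ : algebraMap R Q r ∈ IsLocalization.coeSubmodule Q I :=
        (Submodule.Quotient.mk_eq_zero ((IsLocalization.coeSubmodule Q I).submoduleOf 1)).mp h
      exact hinj h' ▸ hr'
    · intro h
      exact (Submodule.Quotient.mk_eq_zero _).mpr ⟨r, h, rfl⟩
  have hsurj : Function.Surjective g := by
    refine (Submodule.mkQ_surjective _).comp ?_
    rintro ⟨q, hq⟩
    obtain ⟨r, rfl⟩ := Submodule.mem_one.mp hq
    exact ⟨r, rfl⟩
  exact ((Submodule.quotEquivOfEq I g.ker hker.symm).trans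
    (g.quotKerEquivOfSurjective hsurj)).length_eq.symm

end Algebra

end Submodule

/-! ### Reductions, canonical duality and the conductor -/

open IsLocalRing in
/-- By Nakayama's lemma, a minimal generating set of the maximal ideal is linearly independent in
the cotangent space. -/
theorem Ideal.IsMinimalGeneratingSet.finite_and_ncard_le {R : Type*} [CommRing R] [IsLocalRing R]
    [IsNoetherianRing R] {S : Set R} (hS : (maximalIdeal R).IsMinimalGeneratingSet S) :
    S.Finite ∧ S.ncard ≤ embeddingDimension R := by
  have hSm : ∀ s : S, (s : R) ∈ maximalIdeal R := fun s ↦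
    (hS.prop : Ideal.span S = _) ▸ Ideal.subset_span s.2
  let v : S → CotangentSpace R := fun s ↦ (maximalIdeal R).toCotangent ⟨s, hSm s⟩
  have hv : LinearIndependent (IsLocalRing.ResidueField R) v := by
    rw [linearIndependent_iff_notMem_span]
    intro s hs
    rw [← Submodule.restrictScalars_mem R, Submodule.restrictScalars_span R
      (IsLocalRing.ResidueField R) residue_surjective] at hs
    have hle : Submodule.span R (v '' (Set.univ \ {s})) ≤
        (Submodule.comap (maximalIdeal R).subtype (Ideal.span (S \ {(s : R)}))).map
          (maximalIdeal R).toCotangent := by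
      rw [Submodule.span_le]
      rintro _ ⟨t, ht, rfl⟩
      refine ⟨⟨t, hSm t⟩, Ideal.subset_span ⟨t.2, fun h ↦ ht.2 (Subtype.ext h)⟩, rfl⟩
    obtain ⟨t, ht, hts⟩ := hle hs
    have ht' : (t : R) ∈ Ideal.span (S \ {(s : R)}) := ht
    have hsub : (s : R) - t ∈ maximalIdeal R ^ 2 := (Ideal.toCotangent_eq _).mp hts.symm
    have hgen : maximalIdeal R ≤ Ideal.span (S \ {(s : R)}) := by
      refine Submodule.le_of_le_smul_of_le_jacobson_bot (I := maximalIdeal R)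
        (Ideal.fg_of_isNoetherianRing _) (maximalIdeal_le_jacobson _) ?_
      conv_lhs => rw [← (hS.prop : Ideal.span S = _)]
      rw [Ideal.span_le]
      intro r hr
      by_cases hrs : r = s
      · have hsub' : (s : R) - t ∈ maximalIdeal R • maximalIdeal R := by
          rwa [smul_eq_mul, ← sq]
        have hadd := add_mem (S := Submodule R R) (Submodule.mem_sup_left ht')
          (Submodule.mem_sup_right hsub')
        rw [hrs]
        simpa using hadd
      · exact Submodule.mem_sup_left (Ideal.subset_span ⟨hr, hrs⟩)
    have hspan : Ideal.span (S \ {(s : R)}) = maximalIdeal R :=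
      le_antisymm (Ideal.span_le.mpr fun r hr ↦ hSm ⟨r, hr.1⟩) hgen
    exact (hS.le_of_le hspan Set.sdiff_subset s.2).2 rfl
  have hfin : Finite S := hv.finite
  have := Fintype.ofFinite S
  refine ⟨S.toFinite, ?_⟩
  have := hv.fintype_card_le_finrank
  rwa [← Nat.card_eq_fintype_card, Nat.card_coe_set_eq] at this

theorem IsCohenMacaulayLocalRing.exists_mem_nonZeroDivisors {R : Type*} [CommRing R]
    [IsLocalRing R] (hCM : IsCohenMacaulayLocalRing R) (hdim : ringKrullDim R = 1) :
    ∃ t ∈ IsLocalRing.maximalIdeal R, t ∈ nonZeroDivisors R := by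
  obtain ⟨rs, hrs, hreg, hlen⟩ := hCM
  rw [hdim] at hlen
  obtain ⟨t, rfl⟩ : ∃ t, rs = [t] := by
    rw [← List.length_eq_one_iff]
    exact_mod_cast hlen.symm
  refine ⟨t, hrs t (by simp), ?_⟩
  have h := ((RingTheory.Sequence.isRegular_cons_iff R t []).mp hreg).1
  rw [mem_nonZeroDivisors_iff_right]
  intro a ha
  refine h ?_
  change t * a = t * 0
  rw [mul_zero, mul_comm, ha]

theorem Ideal.IsReductionOf.mem_nonZeroDivisors {R : Type*} [CommRing R] {I : Ideal R} {x t : R}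
    (hx : (Ideal.span {x}).IsReductionOf I) (htI : t ∈ I) (ht : t ∈ nonZeroDivisors R) :
    x ∈ nonZeroDivisors R := by
  obtain ⟨-, n, hn⟩ := hx
  have h : t ^ (n + 1) ∈ Ideal.span {x} * I ^ n := by
    rw [hn]
    exact Ideal.pow_mem_pow htI _
  obtain ⟨c, -, hc⟩ := Ideal.mem_span_singleton_mul.mp h
  have := pow_mem ht (n + 1)
  rw [← hc, mul_mem_nonZeroDivisors] at this
  exact this.1

section

variable {R Q : Type*} [CommRing R] [CommRing Q] [Algebra R Q]

/-- If `x` generates a reduction of `I`, then `I R̄ = x R̄` for the integral closure `R̄`. -/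
theorem Ideal.IsReductionOf.exists_isIntegral_mul_eq [IsNoetherianRing R] {I : Ideal R} {x : R}
    (hx : (Ideal.span {x}).IsReductionOf I) (hxu : IsUnit (algebraMap R Q x)) {a : R}
    (ha : a ∈ I) : ∃ z : Q, IsIntegral R z ∧ algebraMap R Q a = algebraMap R Q x * z := by
  obtain ⟨hxI, n, hn⟩ := hx
  rw [Ideal.span_singleton_le_iff_mem] at hxI
  obtain ⟨v, hv⟩ := hxu.exists_right_inv
  refine ⟨v * algebraMap R Q a, ?_, by rw [← mul_assoc, hv, one_mul]⟩
  refine isIntegral_of_forall_mul_mem (N := IsLocalization.coeSubmodule Q (I ^ n))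
    (Submodule.FG.map _ (Ideal.fg_of_isNoetherianRing _))
    (Submodule.mem_map_of_mem (Ideal.pow_mem_pow hxI n)) (by simpa using hxu.pow n) ?_
  rintro _ ⟨b, hb, rfl⟩
  have h : a * b ∈ Ideal.span {x} * I ^ n := by
    rw [hn, pow_succ']
    exact Ideal.mul_mem_mul ha hb
  obtain ⟨c, hc, hcab⟩ := Ideal.mem_span_singleton_mul.mp h
  refine ⟨c, hc, ?_⟩
  have := congrArg (algebraMap R Q) hcab
  rw [map_mul, map_mul] at this
  simp only [Algebra.linearMap_apply]
  linear_combination (-algebraMap R Q c) * hv + v * this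

theorem IsLocalization.coeSubmodule_le_one (I : Ideal R) : IsLocalization.coeSubmodule Q I ≤ 1 :=
  IsLocalization.coeSubmodule_top Q (R := R) ▸ IsLocalization.coeSubmodule_mono Q le_top

theorem coeSubmodule_conductorIdeal :
    IsLocalization.coeSubmodule Q (conductorIdeal R Q) =
      1 / Subalgebra.toSubmodule (integralClosure R Q) := by
  refine Submodule.map_comap_eq_self fun z hz ↦ ?_
  rw [← Submodule.one_eq_range]
  simpa using Submodule.mem_div_iff_forall_mul_mem.mp hz 1 (one_mem (integralClosure R Q))

theorem IsRegularFractionalIdeal.mono {A B : Submodule R Q} (hA : IsRegularFractionalIdeal A)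
    (hBA : B ≤ A) {z : Q} (hzB : z ∈ B) (hz : z ∈ nonZeroDivisors Q) :
    IsRegularFractionalIdeal B := by
  obtain ⟨⟨a, ha, h⟩, -⟩ := hA
  exact ⟨⟨a, ha, fun b hb ↦ h b (hBA hb)⟩, z, hzB, hz⟩

theorem isRegularFractionalIdeal_of_one_le {A : Submodule R Q} (h1 : 1 ≤ A) {a : R}
    (ha : a ∈ nonZeroDivisors R) (h : ∀ z ∈ A, a • z ∈ (1 : Submodule R Q)) :
    IsRegularFractionalIdeal A := by
  refine ⟨⟨a, ha, fun z hz ↦ ?_⟩, 1, h1 (Submodule.one_le.mp le_rfl), one_mem _⟩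
  obtain ⟨r, hr⟩ := Submodule.mem_one.mp (h z hz)
  exact ⟨r, hr⟩

/-- Duality into a canonical ideal does not decrease lengths (in fact, it preserves them). -/
theorem IsCanonicalIdeal.relLength_le {ω : Submodule R Q} (hω : IsCanonicalIdeal ω)
    {A B : Submodule R Q} (hA : IsRegularFractionalIdeal A) (hBA : B ≤ A) {z : Q} (hzB : z ∈ B)
    (hz : z ∈ nonZeroDivisors Q) : B.relLength A ≤ (ω / A).relLength (ω / B) := by
  have hanti : ∀ X Y : Submodule R Q, X ≤ Y → ω / Y ≤ ω / X := fun X Y h ↦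
    Submodule.le_div_iff.mpr fun w hw y hy ↦ Submodule.mem_div_iff_forall_mul_mem.mp hw y (h hy)
  refine Submodule.relLength_le_of_strictAntiOn hBA (fun X ↦ ω / X) ?_ fun X hX ↦
    ⟨hanti _ _ hX.2, hanti _ _ hX.1⟩
  intro X hX Y hY hXY
  refine (hanti X Y hXY.le).lt_of_ne fun heq ↦ hXY.ne ?_
  have hdual : ∀ Z ∈ Set.Icc B A, ω / (ω / Z) = Z := fun Z hZ ↦
    hω.2 Z (hA.mono hZ.2 (hZ.1 hzB) hz)
  rw [← hdual X hX, ← hdual Y hY]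
  exact congrArg (ω / ·) heq.symm

theorem Submodule.div_one_eq (ω : Submodule R Q) : ω / 1 = ω := by
  refine le_antisymm (fun z hz ↦ ?_) (Submodule.le_div_iff_mul_le.mpr (mul_one ω).le)
  simpa using Submodule.mem_div_iff_forall_mul_mem.mp hz 1 (Submodule.one_le.mp le_rfl)

theorem IsCanonicalIdeal.div_self {ω : Submodule R Q} (hω : IsCanonicalIdeal ω) :
    ω / ω = 1 := by
  have h := hω.2 1 (isRegularFractionalIdeal_of_one_le le_rfl (one_mem _) fun z hz ↦ by
    rwa [one_smul])
  rwa [Submodule.div_one_eq] at h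

/-- If `ω R̄ = R̄`, the conductor is the canonical dual of the integral closure `R̄`. -/
theorem IsCanonicalIdeal.one_div_eq_div {ω : Submodule R Q} (hω : IsCanonicalIdeal ω)
    {O : Subalgebra R Q} (hωO : ω ≤ Subalgebra.toSubmodule O)
    (h1 : 1 ∈ ω * Subalgebra.toSubmodule O) :
    1 / Subalgebra.toSubmodule O = ω / Subalgebra.toSubmodule O := by
  apply le_antisymm
  · rw [Submodule.le_div_iff]
    intro z hz o ho
    -- `z R̄ ω ⊆ ω` as `z R̄ ⊆ R`, while `o ∈ R̄ = R̄ ω`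
    have hle : ω * Subalgebra.toSubmodule O ≤
        Submodule.comap (LinearMap.mulLeft R (z * o)) ω := by
      rw [Submodule.mul_le]
      intro w hw o' ho'
      have h := Submodule.mem_div_iff_forall_mul_mem.mp hz _ (O.mul_mem ho ho')
      rw [← hω.div_self] at h
      have := Submodule.mem_div_iff_forall_mul_mem.mp h w hw
      rw [Submodule.mem_comap, LinearMap.mulLeft_apply]
      convert this using 1
      ring
    simpa using hle h1
  · rw [Submodule.le_div_iff, ← hω.div_self]
    intro z hz o ho
    rw [Submodule.mem_div_iff_forall_mul_mem]
    intro w hw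
    rw [mul_assoc]
    exact Submodule.mem_div_iff_forall_mul_mem.mp hz _ (O.mul_mem ho (hωO hw))

end

/-- The multiplicity of a primary ideal whose Hilbert-Samuel function is eventually linear. -/
theorem Ideal.hasHilbertSamuelMultiplicity_of_length_eq {R : Type*} [CommRing R] [IsLocalRing R]
    (hdim : ringKrullDim R = 1) {I : Ideal R} (hI : I.radical = IsLocalRing.maximalIdeal R)
    {l e : ℕ} (h : ∀ n : ℕ, Module.length R (R ⧸ I ^ (n + 1)) = (l + n * e : ℕ)) :
    I.HasHilbertSamuelMultiplicity e := by
  refine ⟨hI, 1, by simpa using hdim, ?_⟩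
  rw [← Filter.tendsto_add_atTop_iff_nat 1]
  have h1 : ∀ n : ℕ, ((1 : ℕ).factorial : ℝ) *
      ((Module.length R (R ⧸ I ^ (n + 1))).toNat : ℝ) / ((n + 1 : ℕ) : ℝ) ^ 1
      = e + ((l : ℝ) - e) * (1 / ((n : ℝ) + 1)) := by
    intro n
    rw [h n, ENat.toNat_natCast]
    have : (n : ℝ) + 1 ≠ 0 := by positivity
    push_cast [Nat.factorial]
    field_simp
    ring
  simp_rw [h1]
  have h2 := (tendsto_one_div_add_atTop_nhds_zero_nat (𝕜 := ℝ)).const_mul ((l : ℝ) - e)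
  simpa using h2.const_add (e : ℝ)

/-! ### The length estimate and the Hilbert-Samuel function of the conductor -/

section

variable {R Q : Type*} [CommRing R] [CommRing Q] [Algebra R Q]

/-- If `I₀ ⊆ x O` for an overring `O` of `R`, and `I = x ω` is a reduction of `I₀ ∋ x`, then
`ω O` contains `1`, as `x ^ (n + 1) ∈ I I₀ ^ n ⊆ x ω x ^ n O`. -/
theorem one_mem_mul_of_isReductionOf {O : Subalgebra R Q} {I I₀ : Ideal R}
    (hI : I.IsReductionOf I₀) {x : R} (hx : x ∈ I₀) (hxu : IsUnit (algebraMap R Q x))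
    (hO : ∀ a ∈ I₀, ∃ z ∈ O, algebraMap R Q a = algebraMap R Q x * z) {ω : Submodule R Q}
    (hIω : IsLocalization.coeSubmodule Q I = x • ω) :
    1 ∈ ω * Subalgebra.toSubmodule O := by
  obtain ⟨-, n, hn⟩ := hI
  have hpow : ∀ k : ℕ, ∀ a ∈ I₀ ^ k, ∃ z ∈ O, algebraMap R Q a = algebraMap R Q x ^ k * z := by
    intro k
    induction k with
    | zero => exact fun a _ ↦ ⟨_, O.algebraMap_mem a, by simp⟩
    | succ k ih =>
      intro a ha
      rw [pow_succ] at ha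
      refine Submodule.mul_induction_on ha (fun b hb c hc ↦ ?_) (fun b c hb hc ↦ ?_)
      · obtain ⟨z, hz, hbz⟩ := ih b hb
        obtain ⟨w, hw, hcw⟩ := hO c hc
        exact ⟨z * w, O.mul_mem hz hw, by rw [map_mul, hbz, hcw]; ring⟩
      · obtain ⟨z, hz, hbz⟩ := hb
        obtain ⟨w, hw, hcw⟩ := hc
        exact ⟨z + w, O.add_mem hz hw, by rw [map_add, hbz, hcw]; ring⟩
  have hmain : ∀ a ∈ I * I₀ ^ n, ∃ t ∈ ω * Subalgebra.toSubmodule O,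
      algebraMap R Q a = algebraMap R Q x ^ (n + 1) * t := by
    intro a ha
    refine Submodule.mul_induction_on ha (fun b hb c hc ↦ ?_) (fun b c hb hc ↦ ?_)
    · have hb' : algebraMap R Q b ∈ x • ω := hIω ▸ Submodule.mem_map_of_mem hb
      obtain ⟨w, hw, hbw⟩ := (Submodule.mem_smul_pointwise_iff_exists _ _ _).mp hb'
      obtain ⟨z, hz, hcz⟩ := hpow n c hc
      refine ⟨w * z, Submodule.mul_mem_mul hw hz, ?_⟩
      rw [map_mul, ← hbw, hcz, Algebra.smul_def]
      ring
    · obtain ⟨z, hz, hbz⟩ := hb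
      obtain ⟨w, hw, hcw⟩ := hc
      exact ⟨z + w, add_mem hz hw, by rw [map_add, hbz, hcw]; ring⟩
  obtain ⟨t, ht, hxt⟩ := hmain (x ^ (n + 1)) (hn ▸ Ideal.pow_mem_pow hx _)
  rw [map_pow] at hxt
  have : t = 1 := (hxu.pow (n + 1)).mul_left_cancel (by rw [← hxt, mul_one])
  rwa [← this]

/-- The central estimate `ℓ(ω / c) ≤ (ν - 1) ℓ(R / c)`, where `c = ω : O` is an ideal of `R` and
`ν = |S|`. With `I₀` the ideal generated by `S`, two chains from `c` to `x⁻¹ I₀` are compared, one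
through `ω` and one through `R + R p` for `p = y / x`. In the first, `p ω ⊆ x⁻¹ I₀` and duality
bound `ℓ(x⁻¹ I₀ / ω)` below by `ℓ((R + R p) / R)`, which cancels the same length in the second. -/
theorem IsCanonicalIdeal.relLength_div_le {ω : Submodule R Q} (hω : IsCanonicalIdeal ω)
    {O : Subalgebra R Q} (hO : IsRegularFractionalIdeal (Subalgebra.toSubmodule O))
    {c : Ideal R} (hc : IsLocalization.coeSubmodule Q c = ω / Subalgebra.toSubmodule O)
    (hinj : Function.Injective (algebraMap R Q))
    (hlen : Module.length R (R ⧸ c) ≠ ⊤)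
    {x y : R} (hxu : IsUnit (algebraMap R Q x)) {S : Finset R} (hxS : x ∈ S) (hyS : y ∈ S)
    (hyx : y ≠ x)
    (hSO : ∀ a ∈ Ideal.span (S : Set R), ∃ z ∈ O, algebraMap R Q a = algebraMap R Q x * z)
    (hx : ∀ w ∈ ω, x • w ∈ IsLocalization.coeSubmodule Q (Ideal.span (S : Set R)))
    (hy : ∀ w ∈ ω, y • w ∈ IsLocalization.coeSubmodule Q (Ideal.span (S : Set R))) :
    (ω / Subalgebra.toSubmodule O).relLength ω ≤
      ((S.card - 1 : ℕ) : ℕ∞) * Module.length R (R ⧸ c) := by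
  classical
  obtain ⟨v, hv⟩ := hxu.exists_right_inv
  set C := ω / Subalgebra.toSubmodule O with hC
  have h1O : (1 : Submodule R Q) ≤ Subalgebra.toSubmodule O := Submodule.one_le.mpr O.one_mem
  have hvO : ∀ a ∈ Ideal.span (S : Set R), v * algebraMap R Q a ∈ O := by
    intro a ha
    obtain ⟨z, hz, haz⟩ := hSO a ha
    rwa [haz, ← mul_assoc, mul_comm v, hv, one_mul]
  set p := v * algebraMap R Q y
  have hpO : p ∈ O := hvO y (Ideal.subset_span hyS)
  -- `P = R + R p`, and `B = x⁻¹ I₀` needs `|S| - 2` further generators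
  set P : Submodule R Q := 1 ⊔ R ∙ p
  set T : Finset Q := ((S.erase x).erase y).image fun a ↦ v * algebraMap R Q a
  set B : Submodule R Q := P ⊔ Submodule.span R T
  have hPO : P ≤ Subalgebra.toSubmodule O :=
    sup_le h1O ((Submodule.span_singleton_le_iff_mem _ _).mpr hpO)
  have hTO : ∀ t ∈ T, t ∈ O := by
    intro t ht
    obtain ⟨a, ha, rfl⟩ := Finset.mem_image.mp ht
    exact hvO a (Ideal.subset_span (Finset.mem_of_mem_erase (Finset.mem_of_mem_erase ha)))
  have h1P : 1 ≤ P := le_sup_left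
  have hPB : P ≤ B := le_sup_left
  have hSB : ∀ a ∈ Ideal.span (S : Set R), v * algebraMap R Q a ∈ B := by
    have : Ideal.span (S : Set R) ≤
        Submodule.comap ((LinearMap.mulLeft R v).comp (Algebra.linearMap R Q)) B := by
      rw [Ideal.span_le]
      intro a ha
      change v * algebraMap R Q a ∈ B
      by_cases hax : a = x
      · rw [hax, mul_comm, hv]
        exact hPB (h1P (Submodule.one_le.mp le_rfl))
      by_cases hay : a = y
      · rw [hay]
        exact hPB (Submodule.mem_sup_right (Submodule.mem_span_singleton_self p))
      · refine Submodule.mem_sup_right (Submodule.subset_span (Finset.mem_image.mpr ⟨a, ?_, rfl⟩))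
        exact Finset.mem_erase.mpr ⟨hay, Finset.mem_erase.mpr ⟨hax, ha⟩⟩
    exact fun a ha ↦ this ha
  have hωB : ω ≤ B := by
    intro w hw
    obtain ⟨a, ha, hxw⟩ := hx w hw
    have := hSB a ha
    rw [Algebra.linearMap_apply] at hxw
    rwa [hxw, Algebra.smul_def, ← mul_assoc, mul_comm v, hv, one_mul] at this
  have hpω : ∀ w ∈ ω, p * w ∈ B := by
    intro w hw
    obtain ⟨a, ha, hyw⟩ := hy w hw
    have := hSB a ha
    rw [Algebra.linearMap_apply] at hyw
    rwa [hyw, Algebra.smul_def, ← mul_assoc] at this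
  have hC1 : C ≤ 1 := by
    rw [← hc]
    exact IsLocalization.coeSubmodule_le_one c
  have hCω : C ≤ ω := fun z hz ↦ by
    simpa using Submodule.mem_div_iff_forall_mul_mem.mp hz 1 O.one_mem
  have hcO : ∀ z ∈ O, ∀ r ∈ c, r • z ∈ C := by
    intro z hz r hr
    have hrC : algebraMap R Q r ∈ C := hc ▸ Submodule.mem_map_of_mem hr
    rw [hC, Submodule.mem_div_iff_forall_mul_mem] at hrC ⊢
    intro o ho
    rw [Algebra.smul_def, mul_assoc]
    exact hrC _ (O.mul_mem hz ho)
  set l := Module.length R (R ⧸ c)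
  have hl1 : C.relLength 1 = l := by rw [← hc, Submodule.relLength_coeSubmodule_one hinj]
  have hPBlen : P.relLength B ≤ T.card * l :=
    Submodule.relLength_sup_span_le T fun t ht r hr ↦ h1P (hC1 (hcO t (hTO t ht) r hr))
  have h1Plen : (1 : Submodule R Q).relLength P ≤ l :=
    Submodule.relLength_sup_span_singleton_le fun r hr ↦ hC1 (hcO p hpO r hr)
  have hone : (1 : Q) ∈ (1 : Submodule R Q) := Submodule.one_le.mp le_rfl
  have hdual : (1 : Submodule R Q).relLength P ≤ ω.relLength B := by
    refine (hω.relLength_le (hO.mono hPO (h1P hone) (one_mem _)) h1P hone (one_mem _)).trans ?_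
    rw [Submodule.div_one_eq]
    refine Submodule.relLength_le_of_linearMap (LinearMap.mulLeft R p) hpω fun w hw ↦ ?_
    rw [LinearMap.mulLeft_apply, Submodule.mem_div_iff_forall_mul_mem]
    constructor
    · intro h z hz
      obtain ⟨a, ha, b, hb, rfl⟩ := Submodule.mem_sup.mp hz
      obtain ⟨r, rfl⟩ := Submodule.mem_one.mp ha
      obtain ⟨s, rfl⟩ := Submodule.mem_span_singleton.mp hb
      rw [mul_add, mul_comm w, ← Algebra.smul_def, mul_smul_comm, mul_comm w]
      exact add_mem (ω.smul_mem r hw) (ω.smul_mem s h)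
    · intro h
      rw [mul_comm]
      exact h p (Submodule.mem_sup_right (Submodule.mem_span_singleton_self p))
  have hchain : C.relLength ω + ω.relLength B
      = l + (1 : Submodule R Q).relLength P + P.relLength B := by
    rw [Submodule.relLength_add hCω hωB, ← hl1, Submodule.relLength_add hC1 h1P,
      Submodule.relLength_add (hC1.trans h1P) hPB]
  have hcard : T.card + 1 ≤ S.card - 1 := by
    have h1 : T.card ≤ ((S.erase x).erase y).card := Finset.card_image_le
    have hy' : y ∈ S.erase x := Finset.mem_erase.mpr ⟨hyx, hyS⟩
    have h2 := Finset.card_erase_add_one hy'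
    have h3 := Finset.card_erase_add_one hxS
    omega
  have hcardlen : l + T.card * l ≤ ((S.card - 1 : ℕ) : ℕ∞) * l := by
    have : ((T.card + 1 : ℕ) : ℕ∞) * l ≤ ((S.card - 1 : ℕ) : ℕ∞) * l := by gcongr
    refine le_trans (le_of_eq ?_) this
    push_cast
    ring
  have hfin : (1 : Submodule R Q).relLength P ≠ ⊤ := ne_top_of_le_ne_top hlen h1Plen
  refine (ENat.add_le_add_iff_right hfin).mp ?_
  calc C.relLength ω + (1 : Submodule R Q).relLength P
      ≤ C.relLength ω + ω.relLength B := by gcongr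
    _ = l + (1 : Submodule R Q).relLength P + P.relLength B := hchain
    _ ≤ l + (1 : Submodule R Q).relLength P + T.card * l := by gcongr
    _ = l + T.card * l + (1 : Submodule R Q).relLength P := by ring
    _ ≤ _ := by gcongr

/-- If the ideal `c` of `R` is a principal ideal `z O` of an overring `O`, its Hilbert-Samuel
function is linear, with slope `ℓ(O / c)`. -/
theorem length_quotient_pow_succ_of_coeSubmodule_eq_smul {O : Subalgebra R Q} {c : Ideal R} {z : Q}
    (hz : IsUnit z) (hinj : Function.Injective (algebraMap R Q))
    (hc : IsLocalization.coeSubmodule Q c = z • Subalgebra.toSubmodule O) (n : ℕ) :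
    Module.length R (R ⧸ c ^ (n + 1)) = Module.length R (R ⧸ c) +
      n * (IsLocalization.coeSubmodule Q c).relLength (Subalgebra.toSubmodule O) := by
  have hmem : ∀ (u q : Q), q ∈ u • Subalgebra.toSubmodule O ↔ ∃ o ∈ O, u * o = q := fun u q ↦ by
    rw [Submodule.mem_smul_pointwise_iff_exists]
    rfl
  have hpow : ∀ n : ℕ, IsLocalization.coeSubmodule Q (c ^ (n + 1))
      = z ^ (n + 1) • Subalgebra.toSubmodule O := by
    intro n
    induction n with
    | zero => simpa using hc
    | succ n ih =>
      rw [pow_succ, IsLocalization.coeSubmodule_mul, ih, hc]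
      apply le_antisymm
      · rw [Submodule.mul_le]
        intro a ha b hb
        obtain ⟨o, ho, rfl⟩ := (hmem _ _).mp ha
        obtain ⟨o', ho', rfl⟩ := (hmem _ _).mp hb
        exact (hmem _ _).mpr ⟨o * o', O.mul_mem ho ho', by ring⟩
      · intro q hq
        obtain ⟨o, ho, rfl⟩ := (hmem _ _).mp hq
        have : z ^ (n + 1 + 1) * o = (z ^ (n + 1) * o) * (z * 1) := by ring
        rw [this]
        exact Submodule.mul_mem_mul ((hmem _ _).mpr ⟨o, ho, rfl⟩)
          ((hmem _ _).mpr ⟨1, O.one_mem, rfl⟩)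
  have hcO : IsLocalization.coeSubmodule Q c ≤ Subalgebra.toSubmodule O := fun q hq ↦ by
    obtain ⟨r, -, rfl⟩ := hq
    exact O.algebraMap_mem r
  induction n with
  | zero => rw [zero_add, pow_one, Nat.cast_zero, zero_mul, add_zero]
  | succ n ih =>
    have hle : c ^ (n + 1 + 1) ≤ c ^ (n + 1) := Ideal.pow_le_pow_right (n + 1).le_succ
    rw [← Submodule.relLength_coeSubmodule_one hinj, ← Submodule.relLength_add
      (IsLocalization.coeSubmodule_mono Q hle) (IsLocalization.coeSubmodule_le_one _),
      Submodule.relLength_coeSubmodule_one hinj (c ^ (n + 1)), ih]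
    have hstep : (IsLocalization.coeSubmodule Q (c ^ (n + 1 + 1))).relLength
        (IsLocalization.coeSubmodule Q (c ^ (n + 1)))
        = (IsLocalization.coeSubmodule Q c).relLength (Subalgebra.toSubmodule O) := by
      rw [hpow, hpow, pow_succ, mul_smul, ← hc, Submodule.relLength_smul (hz.pow _)]
    rw [hstep]
    push_cast
    ring

end

/-! ### The conductor as a principal ideal, and its multiplicity -/

theorem pow_mem_conductorIdeal {R Q : Type*} [CommRing R] [CommRing Q] [Algebra R Q] {x : R}
    {N : ℕ} (hN : ∀ z : Q, IsIntegral R z →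
      ∃ a : R, algebraMap R Q x ^ N * z = algebraMap R Q a) : x ^ N ∈ conductorIdeal R Q := by
  change algebraMap R Q (x ^ N) ∈ 1 / Subalgebra.toSubmodule (integralClosure R Q)
  refine Submodule.mem_div_iff_forall_mul_mem.mpr fun z hz ↦ ?_
  obtain ⟨a, ha⟩ := hN z hz
  rw [map_pow, ha]
  exact Submodule.algebraMap_mem a

/-- If the integral closure `R̄` of a local ring `R` has a power of a parameter `x` as a common
denominator, then the conductor is a principal ideal of `R̄`, generated by a unit of `Q`. -/
theorem exists_coeSubmodule_conductorIdeal_eq_smul {R Q : Type*} [CommRing R] [IsLocalRing R]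
    [IsNoetherianRing R] [CommRing Q] [Algebra R Q] {x : R} (hxu : IsUnit (algebraMap R Q x))
    (hxm : x ∈ IsLocalRing.maximalIdeal R) {k : ℕ}
    (hk : IsLocalRing.maximalIdeal R ^ k ≤ Ideal.span {x}) {N : ℕ}
    (hN : ∀ z : Q, IsIntegral R z → ∃ a : R, algebraMap R Q x ^ N * z = algebraMap R Q a) :
    ∃ z : Q, IsUnit z ∧ IsLocalization.coeSubmodule Q (conductorIdeal R Q) =
      z • Subalgebra.toSubmodule (integralClosure R Q) := by
  set m := IsLocalRing.maximalIdeal R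
  set O := integralClosure R Q
  set c := conductorIdeal R Q
  have h1O : (1 : Submodule R Q) ≤ Subalgebra.toSubmodule O := Submodule.one_le.mpr O.one_mem
  have hc1 : IsLocalization.coeSubmodule Q c = 1 / Subalgebra.toSubmodule O :=
    coeSubmodule_conductorIdeal
  have hcC : IsLocalization.coeSubmodule Q c ≤ 1 := IsLocalization.coeSubmodule_le_one c
  have hxNc : x ^ N ∈ c := pow_mem_conductorIdeal hN
  have hfinite : Module.Finite R O := by
    obtain ⟨v, hv⟩ := (hxu.pow N).exists_right_inv
    have hle : Subalgebra.toSubmodule O ≤ R ∙ v := by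
      intro z hz
      obtain ⟨a, ha⟩ := hN z hz
      refine Submodule.mem_span_singleton.mpr ⟨a, ?_⟩
      rw [Algebra.smul_def, ← ha]
      linear_combination z * hv
    have : IsNoetherian R (R ∙ v) :=
      isNoetherian_of_fg_of_noetherian _ (Submodule.fg_span_singleton v)
    exact Module.Finite.iff_fg.mpr (isNoetherian_submodule.mp this _ hle)
  have hnoeth : IsNoetherianRing O := IsNoetherianRing.of_finite R O
  have hOcap : ∀ P : Ideal O, P.IsPrime → algebraMap R O x ∈ P → P.IsMaximal := by
    intro P hP hxP
    have hcomap : m ≤ P.comap (algebraMap R O) := by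
      have h1 : m ^ k ≤ P.comap (algebraMap R O) :=
        hk.trans ((Ideal.span_singleton_le_iff_mem _).mpr hxP)
      exact (hP.comap (algebraMap R O)).le_of_pow_le h1
    refine Ideal.isMaximal_of_isIntegral_of_isMaximal_comap (R := R) P ?_
    rw [← (IsLocalRing.maximalIdeal.isMaximal R).eq_of_le (hP.comap _).ne_top hcomap]
    exact IsLocalRing.maximalIdeal.isMaximal R
  let J : Ideal O :=
    { carrier := {o | (o : Q) ∈ IsLocalization.coeSubmodule Q c}
      zero_mem' := (IsLocalization.coeSubmodule Q c).zero_mem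
      add_mem' := fun ha hb ↦ (IsLocalization.coeSubmodule Q c).add_mem ha hb
      smul_mem' := by
        intro o a ha
        change (o : Q) * a ∈ IsLocalization.coeSubmodule Q c
        have ha' : (a : Q) ∈ IsLocalization.coeSubmodule Q c := ha
        rw [hc1, Submodule.mem_div_iff_forall_mul_mem] at ha' ⊢
        intro z hz
        rw [mul_comm (o : Q), mul_assoc]
        exact ha' _ (O.mul_mem o.2 hz) }
  have hJ : J.IsPrincipal := by
    refine Ideal.isPrincipal_of_pow_mem (Q := Q) (x := algebraMap R O x) (k := N)
      Subtype.val_injective hxu ?_ hOcap ?_ J ?_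
    · intro q hq
      exact ⟨⟨q, isIntegral_trans (R := R) q hq⟩, rfl⟩
    · intro M hM
      have := Ideal.isMaximal_comap_of_isIntegral_of_isMaximal (R := R) M
      have h := IsLocalRing.eq_maximalIdeal this
      change x ∈ M.comap (algebraMap R O)
      rwa [h]
    · exact ⟨x ^ N, hxNc, by simp⟩
  obtain ⟨z, hz⟩ := hJ
  have hcz : IsLocalization.coeSubmodule Q c = (z : Q) • Subalgebra.toSubmodule O := by
    ext q
    rw [Submodule.mem_smul_pointwise_iff_exists]
    constructor
    · intro hq
      have hqO : q ∈ O := h1O (hcC hq)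
      have hqJ : (⟨q, hqO⟩ : O) ∈ J := hq
      rw [hz] at hqJ
      obtain ⟨o, ho⟩ := Submodule.mem_span_singleton.mp hqJ
      refine ⟨o, o.2, ?_⟩
      rw [smul_eq_mul, mul_comm]
      exact congrArg Subtype.val ho
    · rintro ⟨o, ho, rfl⟩
      have : z * ⟨o, ho⟩ ∈ J := J.mul_mem_right _ (hz ▸ Submodule.mem_span_singleton_self z)
      exact this
  have hzu : IsUnit (z : Q) := by
    have h1 : algebraMap R Q (x ^ N) ∈ (z : Q) • Subalgebra.toSubmodule O :=
      hcz ▸ Submodule.mem_map_of_mem hxNc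
    obtain ⟨o, -, ho⟩ := (Submodule.mem_smul_pointwise_iff_exists _ _ _).mp h1
    rw [map_pow, smul_eq_mul] at ho
    exact isUnit_of_mul_isUnit_left (ho ▸ hxu.pow N)
  exact ⟨z, hzu, hcz⟩

theorem corollary2p3 {R Q : Type*} [CommRing R] [IsLocalRing R] [IsNoetherianRing R]
    [CommRing Q] [Algebra R Q] [IsFractionRing R Q]
    (hdim : ringKrullDim R = 1)
    (hCM : IsCohenMacaulayLocalRing R)
    (hunr : IsAnalyticallyUnramified R)
    (hres : Infinite (IsLocalRing.ResidueField R))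
    (x : R) (hx : (Ideal.span {x}).IsMinimalReductionOf (IsLocalRing.maximalIdeal R))
    (ω : Submodule R Q) (hω : IsCanonicalIdeal ω)
    (I : Ideal R) (hI : IsCanonicalReduction Q I)
    (hIω : IsLocalization.coeSubmodule Q I = x • ω)
    (S : Set R) (hS : (IsLocalRing.maximalIdeal R).IsMinimalGeneratingSet S) (hxS : x ∈ S)
    (y : R) (hyS : y ∈ S) (hyx : y ≠ x)
    (hyω : algebraMap R Q y ∈
      IsLocalization.coeSubmodule Q (IsLocalRing.maximalIdeal R) / ω) :
    ∃ e : ℕ, (conductorIdeal R Q).HasHilbertSamuelMultiplicity e ∧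
      (e : ℕ∞) ≤ (embeddingDimension R : ℕ∞) * Module.length R (R ⧸ conductorIdeal R Q) := by
  have hxred : (Ideal.span {x}).IsReductionOf (IsLocalRing.maximalIdeal R) := hx.prop
  have hxm : x ∈ IsLocalRing.maximalIdeal R :=
    (Ideal.span_singleton_le_iff_mem _).mp hxred.1
  obtain ⟨t, htm, ht⟩ := hCM.exists_mem_nonZeroDivisors hdim
  have hx0 : x ∈ nonZeroDivisors R := hxred.mem_nonZeroDivisors htm ht
  have hinj : Function.Injective (algebraMap R Q) := IsFractionRing.injective R Q
  have hxu : IsUnit (algebraMap R Q x) :=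
    IsLocalization.map_units Q (⟨x, hx0⟩ : nonZeroDivisors R)
  set m := IsLocalRing.maximalIdeal R
  obtain ⟨k, hk⟩ : ∃ k, m ^ k ≤ Ideal.span {x} := by
    obtain ⟨-, n, hn⟩ := hxred
    exact ⟨n + 1, hn ▸ Ideal.mul_le_left⟩
  -- the integral closure `O` has the common denominator `x ^ N`
  obtain ⟨N, hN⟩ := exists_forall_isIntegral_pow_mul_eq_of_isAnalyticallyUnramified (Q := Q)
    hdim.le hunr hx0 hxm hk
  set O := integralClosure R Q
  set c := conductorIdeal R Q
  have hxN0 : x ^ N ∈ nonZeroDivisors R := pow_mem hx0 N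
  have h1O : (1 : Submodule R Q) ≤ Subalgebra.toSubmodule O := Submodule.one_le.mpr O.one_mem
  have hOone : ∀ z ∈ O, x ^ N • z ∈ (1 : Submodule R Q) := by
    intro z hz
    obtain ⟨a, ha⟩ := hN z hz
    rw [Algebra.smul_def, map_pow, ha]
    exact Submodule.algebraMap_mem a
  have hOfrac : IsRegularFractionalIdeal (Subalgebra.toSubmodule O) :=
    isRegularFractionalIdeal_of_one_le h1O hxN0 hOone
  have hmO : ∀ a ∈ m, ∃ z ∈ O, algebraMap R Q a = algebraMap R Q x * z := fun a ha ↦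
    hxred.exists_isIntegral_mul_eq hxu ha
  have hωm : ∀ w ∈ ω, x • w ∈ IsLocalization.coeSubmodule Q m := by
    intro w hw
    refine IsLocalization.coeSubmodule_mono Q hI.2.1 ?_
    rw [hIω]
    exact Submodule.smul_mem_pointwise_smul w x ω hw
  have hωO : ω ≤ Subalgebra.toSubmodule O := by
    intro w hw
    obtain ⟨a, ha, haw⟩ := hωm w hw
    obtain ⟨z, hz, haz⟩ := hmO a ha
    rw [Algebra.linearMap_apply, haz, Algebra.smul_def] at haw
    exact hxu.mul_left_cancel haw ▸ hz
  have h1ω : 1 ∈ ω * Subalgebra.toSubmodule O :=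
    one_mem_mul_of_isReductionOf hI.2 hxm hxu hmO hIω
  have hc1 : IsLocalization.coeSubmodule Q c = 1 / Subalgebra.toSubmodule O :=
    coeSubmodule_conductorIdeal
  have hcω : IsLocalization.coeSubmodule Q c = ω / Subalgebra.toSubmodule O :=
    hc1.trans (hω.one_div_eq_div hωO h1ω)
  have hxNc : x ^ N ∈ c := pow_mem_conductorIdeal hN
  have hlen : Module.length R (R ⧸ c) ≠ ⊤ := by
    have : Ring.KrullDimLE 1 R := Ring.krullDimLE_iff.mpr (by simpa using hdim.le)
    exact ne_top_of_le_ne_top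
      (Module.length_ne_top_iff.mpr (isFiniteLength_quotient_span_singleton R hxN0))
      (Module.length_le_of_surjective
        (Submodule.factor ((Ideal.span_singleton_le_iff_mem c).mpr hxNc))
        (Submodule.factor_surjective _))
  have hcC : IsLocalization.coeSubmodule Q c ≤ 1 := IsLocalization.coeSubmodule_le_one c
  obtain ⟨hSfin, hScard⟩ := hS.finite_and_ncard_le
  -- the estimate
  have hmain : (IsLocalization.coeSubmodule Q c).relLength (Subalgebra.toSubmodule O)
      ≤ (embeddingDimension R : ℕ∞) * Module.length R (R ⧸ c) := by
    set S' := hSfin.toFinset with hS'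
    have hspan : Ideal.span (S' : Set R) = m := by rw [hS', hSfin.coe_toFinset]; exact hS.prop
    have hxS' : x ∈ S' := hSfin.mem_toFinset.mpr hxS
    have hcard : S'.card ≤ embeddingDimension R := by
      rwa [← Set.ncard_eq_toFinset_card S hSfin]
    have hest := hω.relLength_div_le hOfrac hcω hinj hlen hxu hxS'
      (hSfin.mem_toFinset.mpr hyS) hyx (by rwa [hspan]) (by rwa [hspan]) (by
        rw [hspan]
        intro w hw
        rw [Algebra.smul_def]
        exact Submodule.mem_div_iff_forall_mul_mem.mp hyω w hw)
    have hdual : (1 : Submodule R Q).relLength (Subalgebra.toSubmodule O) ≤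
        (ω / Subalgebra.toSubmodule O).relLength ω := by
      have := hω.relLength_le hOfrac h1O (Submodule.one_le.mp le_rfl) (one_mem _)
      rwa [Submodule.div_one_eq] at this
    rw [← Submodule.relLength_add hcC h1O, Submodule.relLength_coeSubmodule_one hinj]
    calc Module.length R (R ⧸ c) + (1 : Submodule R Q).relLength (Subalgebra.toSubmodule O)
        ≤ Module.length R (R ⧸ c) + ((S'.card - 1 : ℕ) : ℕ∞) * Module.length R (R ⧸ c) := by
          gcongr
          exact hdual.trans hest
      _ = ((S'.card - 1 + 1 : ℕ) : ℕ∞) * Module.length R (R ⧸ c) := by push_cast; ring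
      _ ≤ (embeddingDimension R : ℕ∞) * Module.length R (R ⧸ c) := by
          have : S'.card - 1 + 1 ≤ embeddingDimension R := by
            have := Finset.card_pos.mpr ⟨x, hxS'⟩
            omega
          gcongr
  obtain ⟨z, hzu, hcz⟩ := exists_coeSubmodule_conductorIdeal_eq_smul hxu hxm hk hN
  -- the conductor is `m`-primary
  have hcne : c ≠ ⊤ := by
    intro hctop
    have hO1 : Subalgebra.toSubmodule O ≤ 1 := by
      have : (1 : Q) ∈ 1 / Subalgebra.toSubmodule O := by
        rw [← hc1, hctop, IsLocalization.coeSubmodule_top]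
        exact Submodule.one_le.mp le_rfl
      exact Submodule.one_mem_div.mp this
    -- then `m = (x)`, and a minimal generating set containing `x` has no second element
    have hspan : Ideal.span {x} = m := by
      refine le_antisymm hxred.1 fun a ha ↦ ?_
      obtain ⟨w, hw, haw⟩ := hmO a ha
      obtain ⟨r, rfl⟩ := Submodule.mem_one.mp (hO1 hw)
      exact Ideal.mem_span_singleton.mpr ⟨r, hinj (by rw [haw, map_mul])⟩
    exact hyx (hS.le_of_le hspan (Set.singleton_subset_iff.mpr hxS) hyS)
  have hrad : c.radical = m := by
    apply le_antisymm
    · exact (IsLocalRing.maximalIdeal.isMaximal R).isPrime.radical_le_iff.mpr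
        (IsLocalRing.le_maximalIdeal hcne)
    · intro a ha
      refine ⟨k * N, ?_⟩
      have h1 : m ^ (k * N) ≤ c := by
        rw [pow_mul]
        refine (Ideal.pow_right_mono hk N).trans ?_
        rwa [Ideal.span_singleton_pow, Ideal.span_singleton_le_iff_mem]
      exact h1 (Ideal.pow_mem_pow ha _)
  obtain ⟨l, hl⟩ := ENat.ne_top_iff_exists.mp hlen
  obtain ⟨e, he⟩ := ENat.ne_top_iff_exists.mp (ne_top_of_le_ne_top
    (WithTop.mul_ne_top (ENat.natCast_ne_top _) hlen) hmain)
  refine ⟨e, Ideal.hasHilbertSamuelMultiplicity_of_length_eq hdim hrad (l := l) fun n ↦ ?_, ?_⟩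
  · rw [length_quotient_pow_succ_of_coeSubmodule_eq_smul hzu hinj hcz, ← hl, ← he]
    push_cast
    rfl
  · rw [he]
    exact hmain
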